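/- Let $\Omega\subset\mathbb{R}^{n}$ be a bounded Lipschitz domain with outward unit normal $\widehat{\mathbf n}$, and let its boundary be split into two disjoint measurable parts, $\partial\Omega=\Gamma_u\cup\Gamma_p$, $\Gamma_u\cap\Gamma_p=\emptyset$, where $\Gamma_p$ has positive surface measure. Let $$\mathcal U=H^1(\Omega)\times H(\mathrm{div};\Omega,\Gamma_u),\qquad H(\mathrm{div};\Omega,\Gamma_u)=\{\mathbf u\in H(\mathrm{div};\Omega):\ \mathbf u\cdot\widehat{\mathbf n}\in L^2(\Gamma_u)\},$$ with elements $\mathbb U=(\mathcal P,\mathbf u)$, $\mathbb W=(q,\mathbf w)$ and with the norm $$\|\mathbb U\|_{\mathcal U}^2=\|\mathcal P\|_{L^2(\Omega)}^2+\|\mathrm{grad}\,\mathcal P\|_{L^2(\Omega)}^2+\|\mathbf u\|_{L^2(\Omega)}^2+\|\mathrm{div}\,\mathbf u\|_{L^2(\Omega)}^2+\|\mathbf u\cdot\widehat{\mathbf n}\|_{L^2(\Gamma_u)}^2 .$$ There is a constant $C>0$, depending only on $\Omega$ and $\Gamma_p$, with $\|p\|_{L^2(\Gamma_p)}\le C\,\|p\|_{H^1(\Omega)}$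 for all $p\in H^1(\Omega)$, the boundary values of $p$ being taken in the sense of traces. Let $C_{\mathrm{tr}}>0$ be any such constant. Let $\mu>0$ and $0<k_{\min}\le k_{\max}<\infty$, and let $\mathbf K\in L^\infty(\Omega;\mathbb R^{n\times n})$ be symmetric almost everywhere with $k_{\min}\|\boldsymbol\xi\|^2\le\boldsymbol\xi\cdot\mathbf K(\mathbf x)\boldsymbol\xi\le k_{\max}\|\boldsymbol\xi\|^2$ for almost every $\mathbf x\in\Omega$ and all $\boldsymbol\xi\in\mathbb R^n$. Define $$\mathcal B(\mathbb W;\mathbb U)=\int_\Omega\big(\mu\mathbf K^{-1}\mathbf w+\mathrm{grad}\,q\big)\cdot\tfrac1\mu\mathbf K\big(\mu\mathbf K^{-1}\mathbf u+\mathrm{grad}\,\mathcal P\big)\,d\Omega+\int_\Omega \mathrm{div}\,\mathbf w\;\mathrm{div}\,\mathbf u\,d\Omega+\int_{\Gamma_u}(\mathbf w\cdot\widehat{\mathbf n})(\mathbf u\cdot\widehat{\mathbf n})\,d\Gamma+\int_{\Gamma_p}q\,\mathcal P\,d\Gamma .$$ Then $\mathcal B$ is bounded on $\mathcal U\times\mathcal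 U$: for all $\mathbb W,\mathbb U\in\mathcal U$, $$|\mathcal B(\mathbb W;\mathbb U)|\le C_B\,\|\mathbb W\|_{\mathcal U}\,\|\mathbb U\|_{\mathcal U},\qquad C_B=C_1+2+C_{\mathrm{tr}}^2,\qquad C_1=\frac{k_{\max}}{\mu}\big(\mu k_{\min}^{-1}+1\big)^2 .$$ -/

import Mathlib

open MeasureTheory Filter Topology
open scoped ENNReal ContDiff Gradient RealInnerProductSpace

noncomputable section

namespace LeastSquaresDarcy

/-- The ambient space `ℝⁿ` with the Euclidean norm. -/
abbrev Space (n : ℕ) : Type := EuclideanSpace ℝ (Fin n)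

variable {n : ℕ}

/-- Near the point `x`, the set `Ω` is, in a suitable Cartesian coordinate system, the strict epigraph
of a Lipschitz function `γ`.  The last coordinate axis is spanned by the unit vector `ν`, and `γ` is
a function of the remaining coordinates, that is, of the orthogonal projection onto the hyperplane
orthogonal to `ν`. -/
def IsLipschitzEpigraphNear (Ω : Set (Space n)) (x : Space n) : Prop :=
  ∃ (ν : Space n) (γ : (ℝ ∙ ν)ᗮ → ℝ) (L : NNReal) (r : ℝ),
    ‖ν‖ = 1 ∧ LipschitzWith L γ ∧ 0 < r ∧
    ∀ y ∈ Metric.ball x r, y ∈ Ω ↔ γ ((ℝ ∙ ν)ᗮ.orthogonalProjectionOnto y) < ⟪ν, y⟫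

/-- Bounded open sets with Lipschitz boundary (connectedness is not required). -/
structure IsBoundedLipschitz (Ω : Set (Space n)) : Prop where
  isOpen : IsOpen Ω
  isBounded : Bornology.IsBounded Ω
  lipschitz : ∀ x ∈ frontier Ω, IsLipschitzEpigraphNear Ω x

/-- Lebesgue measure on `Ω`. -/
abbrev vol (Ω : Set (Space n)) : Measure (Space n) := volume.restrict Ω

/-- Surface measure on `∂Ω`: the `(n-1)`-dimensional Hausdorff measure, with its usual (Euclidean)
normalization, restricted to the boundary. -/
abbrev surf (Ω : Set (Space n)) : Measure (Space n) :=
  (μHE[n - 1] : Measure (Space n)).restrict (frontier Ω)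

/-- Surface measure on a portion `Γ` of `∂Ω`. -/
abbrev surfOn (Ω Γ : Set (Space n)) : Measure (Space n) := (surf Ω).restrict Γ

/-- Test functions in `C_c^∞(ℝⁿ)`. -/
def IsTest (φ : Space n → ℝ) : Prop := ContDiff ℝ ∞ φ ∧ HasCompactSupport φ

/-- `G` is the weak gradient of `p` in `Ω`. -/
def IsWeakGrad (Ω : Set (Space n)) (p : Lp ℝ 2 (vol Ω)) (G : Lp (Space n) 2 (vol Ω)) : Prop :=
  ∀ φ : Space n → ℝ, IsTest φ → tsupport φ ⊆ Ω →
    ∫ x in Ω, p x • ∇ φ x = - ∫ x in Ω, φ x • G x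

/-- `d` is the weak divergence of `u` in `Ω`. -/
def IsWeakDiv (Ω : Set (Space n)) (u : Lp (Space n) 2 (vol Ω)) (d : Lp ℝ 2 (vol Ω)) : Prop :=
  ∀ φ : Space n → ℝ, IsTest φ → tsupport φ ⊆ Ω →
    ∫ x in Ω, ⟪u x, ∇ φ x⟫ = - ∫ x in Ω, d x * φ x

/-- The normal trace `u • n̂` of a field `u` with weak divergence `d` is, on the portion `Γ` of the
boundary, the function `h`.  The normal trace is the functional on boundary values given by Green's
formula `⟨u • n̂, v⟩ = ∫_Ω (u • grad v + d v)` (`n̂` is the outward unit normal), and it is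
tested against the smooth `v` whose support meets `∂Ω` only inside `Γ`. -/
def IsNormalTrace (Ω Γ : Set (Space n)) (u : Lp (Space n) 2 (vol Ω)) (d : Lp ℝ 2 (vol Ω))
    (h : Lp ℝ 2 (surfOn Ω Γ)) : Prop :=
  ∀ v : Space n → ℝ, IsTest v → tsupport v ∩ frontier Ω ⊆ Γ →
    Integrable (fun x => h x * v x) (surfOn Ω Γ) ∧
    ∫ x in Ω, (⟪u x, ∇ v x⟫ + d x * v x) = ∫ x, h x * v x ∂(surfOn Ω Γ)

/-! Auxiliary facts: integrability of the pairings with test functions, for the linear structure. -/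

theorem IsTest.memLp {φ : Space n → ℝ} (h : IsTest φ) (Ω : Set (Space n)) :
    MemLp φ 2 (vol Ω) :=
  (h.1.continuous.memLp_of_hasCompactSupport h.2).restrict Ω

theorem IsTest.memLp_grad {φ : Space n → ℝ} (h : IsTest φ) (Ω : Set (Space n)) :
    MemLp (∇ φ) 2 (vol Ω) := by
  have hc : Continuous (∇ φ) :=
    (InnerProductSpace.toDual ℝ (Space n)).symm.continuous.comp
      (h.1.continuous_fderiv (by simp))
  have hs : HasCompactSupport (∇ φ) :=
    (h.2.fderiv (𝕜 := ℝ)).comp_left (g := (InnerProductSpace.toDual ℝ (Space n)).symm)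
      (map_zero _)
  exact (hc.memLp_of_hasCompactSupport hs).restrict Ω

theorem IsTest.integrable_smul_grad {φ : Space n → ℝ} (h : IsTest φ) {Ω : Set (Space n)}
    (p : Lp ℝ 2 (vol Ω)) : Integrable (fun x => p x • ∇ φ x) (vol Ω) :=
  memLp_one_iff_integrable.1 ((h.memLp_grad Ω).smul (Lp.memLp p))

theorem IsTest.integrable_smul {φ : Space n → ℝ} (h : IsTest φ) {Ω : Set (Space n)}
    (G : Lp (Space n) 2 (vol Ω)) : Integrable (fun x => φ x • G x) (vol Ω) :=
  memLp_one_iff_integrable.1 ((Lp.memLp G).smul (h.memLp Ω))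

theorem IsTest.integrable_inner {φ : Space n → ℝ} (h : IsTest φ) {Ω : Set (Space n)}
    (u : Lp (Space n) 2 (vol Ω)) : Integrable (fun x => ⟪u x, ∇ φ x⟫) (vol Ω) :=
  ((L2.integrable_inner (𝕜 := ℝ) u ((h.memLp_grad Ω).toLp _))).congr (by
    filter_upwards [(h.memLp_grad Ω).coeFn_toLp] with x hx
    rw [hx])

theorem IsTest.integrable_mul {φ : Space n → ℝ} (h : IsTest φ) {Ω : Set (Space n)}
    (d : Lp ℝ 2 (vol Ω)) : Integrable (fun x => d x * φ x) (vol Ω) :=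
  (Lp.memLp d).integrable_mul (h.memLp Ω)

/-- The Sobolev space `H¹(Ω)`; an element is a function together with its weak gradient. -/
def H1 (Ω : Set (Space n)) : Submodule ℝ (Lp ℝ 2 (vol Ω) × Lp (Space n) 2 (vol Ω)) where
  carrier := {z | IsWeakGrad Ω z.1 z.2}
  zero_mem' := by
    intro φ hφ hs
    have h1 : ∫ x in Ω, (0 : Lp ℝ 2 (vol Ω)) x • ∇ φ x = 0 := by
      refine integral_eq_zero_of_ae ?_
      filter_upwards [Lp.coeFn_zero ℝ 2 (vol Ω)] with x hx
      rw [hx, Pi.zero_apply, zero_smul, Pi.zero_apply]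
    have h2 : ∫ x in Ω, φ x • (0 : Lp (Space n) 2 (vol Ω)) x = 0 := by
      refine integral_eq_zero_of_ae ?_
      filter_upwards [Lp.coeFn_zero (Space n) 2 (vol Ω)] with x hx
      rw [hx, Pi.zero_apply, smul_zero]
    exact h1.trans (by rw [Prod.snd_zero, h2, neg_zero])
  add_mem' := by
    rintro ⟨p, G⟩ ⟨q, H⟩ hp hq φ hφ hs
    have h1 : ∫ x in Ω, (p + q : Lp ℝ 2 (vol Ω)) x • ∇ φ x =
        ∫ x in Ω, (p x • ∇ φ x + q x • ∇ φ x) := by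
      refine integral_congr_ae ?_
      filter_upwards [Lp.coeFn_add p q] with x hx
      rw [hx, Pi.add_apply, add_smul]
    have h2 : ∫ x in Ω, φ x • (G + H : Lp (Space n) 2 (vol Ω)) x =
        ∫ x in Ω, (φ x • G x + φ x • H x) := by
      refine integral_congr_ae ?_
      filter_upwards [Lp.coeFn_add G H] with x hx
      rw [hx, Pi.add_apply, smul_add]
    have e1 := hp φ hφ hs
    have e2 := hq φ hφ hs
    simp only at e1 e2
    rw [integral_add (hφ.integrable_smul_grad p) (hφ.integrable_smul_grad q)] at h1
    rw [integral_add (hφ.integrable_smul G) (hφ.integrable_smul H)] at h2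
    simp only [Prod.mk_add_mk]
    rw [h1, h2, e1, e2, neg_add]
  smul_mem' := by
    rintro c ⟨p, G⟩ hp φ hφ hs
    have h1 : ∫ x in Ω, (c • p : Lp ℝ 2 (vol Ω)) x • ∇ φ x = ∫ x in Ω, c • (p x • ∇ φ x) := by
      refine integral_congr_ae ?_
      filter_upwards [Lp.coeFn_smul c p] with x hx
      rw [hx, Pi.smul_apply, smul_eq_mul, mul_smul]
    have h2 : ∫ x in Ω, φ x • (c • G : Lp (Space n) 2 (vol Ω)) x =
        ∫ x in Ω, c • (φ x • G x) := by
      refine integral_congr_ae ?_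
      filter_upwards [Lp.coeFn_smul c G] with x hx
      rw [hx, Pi.smul_apply, smul_comm]
    have e1 := hp φ hφ hs
    simp only at e1
    rw [integral_smul] at h1 h2
    simp only [Prod.smul_mk]
    rw [h1, h2, e1, smul_neg]

/-- The space `H(div; Ω, Γ)`; an element is a field `u` together with its weak divergence and its
normal trace `u • n̂ ∈ L²(Γ)`. -/
def HDiv (Ω Γ : Set (Space n)) :
    Submodule ℝ (Lp (Space n) 2 (vol Ω) × Lp ℝ 2 (vol Ω) × Lp ℝ 2 (surfOn Ω Γ)) where
  carrier := {z | IsWeakDiv Ω z.1 z.2.1 ∧ IsNormalTrace Ω Γ z.1 z.2.1 z.2.2}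
  zero_mem' := by
    have a1 (φ : Space n → ℝ) : (fun x => ⟪(0 : Lp (Space n) 2 (vol Ω)) x, ∇ φ x⟫)
        =ᵐ[vol Ω] 0 := by
      filter_upwards [Lp.coeFn_zero (Space n) 2 (vol Ω)] with x hx
      rw [hx, Pi.zero_apply, inner_zero_left, Pi.zero_apply]
    have a2 (φ : Space n → ℝ) : (fun x => (0 : Lp ℝ 2 (vol Ω)) x * φ x) =ᵐ[vol Ω] 0 := by
      filter_upwards [Lp.coeFn_zero ℝ 2 (vol Ω)] with x hx
      rw [hx, Pi.zero_apply, zero_mul]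
    have a3 (φ : Space n → ℝ) : (fun x => (0 : Lp ℝ 2 (surfOn Ω Γ)) x * φ x)
        =ᵐ[surfOn Ω Γ] 0 := by
      filter_upwards [Lp.coeFn_zero ℝ 2 (surfOn Ω Γ)] with x hx
      rw [hx, Pi.zero_apply, zero_mul]
    refine ⟨fun φ hφ hs => ?_, fun v hv hs => ⟨?_, ?_⟩⟩
    · have h1 := integral_eq_zero_of_ae (a1 φ)
      have h2 := integral_eq_zero_of_ae (a2 φ)
      exact h1.trans (by rw [Prod.snd_zero, Prod.fst_zero, h2, neg_zero])
    · exact (integrable_zero _ _ _).congr (a3 v).symm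
    · have h1 := integral_eq_zero_of_ae ((a1 v).add (a2 v) |>.trans (by simp))
      have h2 := integral_eq_zero_of_ae (a3 v)
      exact h1.trans h2.symm
  add_mem' := by
    rintro ⟨u, d, h⟩ ⟨w, e, k⟩ ⟨hu, hh⟩ ⟨hw, hk⟩
    have a1 (φ : Space n → ℝ) : (fun x => ⟪(u + w : Lp (Space n) 2 (vol Ω)) x, ∇ φ x⟫)
        =ᵐ[vol Ω] fun x => ⟪u x, ∇ φ x⟫ + ⟪w x, ∇ φ x⟫ := by
      filter_upwards [Lp.coeFn_add u w] with x hx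
      rw [hx, Pi.add_apply, inner_add_left]
    have a2 (φ : Space n → ℝ) : (fun x => (d + e : Lp ℝ 2 (vol Ω)) x * φ x)
        =ᵐ[vol Ω] fun x => d x * φ x + e x * φ x := by
      filter_upwards [Lp.coeFn_add d e] with x hx
      rw [hx, Pi.add_apply, add_mul]
    have a3 (φ : Space n → ℝ) : (fun x => (h + k : Lp ℝ 2 (surfOn Ω Γ)) x * φ x)
        =ᵐ[surfOn Ω Γ] fun x => h x * φ x + k x * φ x := by
      filter_upwards [Lp.coeFn_add h k] with x hx
      rw [hx, Pi.add_apply, add_mul]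
    refine ⟨fun φ hφ hs => ?_, fun v hv hs => ⟨?_, ?_⟩⟩
    · have e1 := hu φ hφ hs
      have e2 := hw φ hφ hs
      simp only at e1 e2
      simp only [Prod.mk_add_mk]
      rw [integral_congr_ae (a1 φ), integral_congr_ae (a2 φ),
        integral_add (hφ.integrable_inner u) (hφ.integrable_inner w),
        integral_add (hφ.integrable_mul d) (hφ.integrable_mul e), e1, e2, neg_add]
    · exact ((hh v hv hs).1.add (hk v hv hs).1).congr (a3 v).symm
    · have e1 := (hh v hv hs).2
      have e2 := (hk v hv hs).2
      simp only at e1 e2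
      simp only [Prod.mk_add_mk]
      rw [integral_congr_ae (a3 v)]
      refine (integral_congr_ae ((a1 v).add (a2 v))).trans ?_
      rw [
        integral_add (hh v hv hs).1 (hk v hv hs).1, ← e1, ← e2]
      refine Eq.trans ?_ (integral_add ((hv.integrable_inner u).add (hv.integrable_mul d))
        ((hv.integrable_inner w).add (hv.integrable_mul e)))
      refine integral_congr_ae (Eventually.of_forall fun x => ?_)
      simp only [Pi.add_apply]
      ring
  smul_mem' := by
    rintro c ⟨u, d, h⟩ ⟨hu, hh⟩
    have a1 (φ : Space n → ℝ) : (fun x => ⟪(c • u : Lp (Space n) 2 (vol Ω)) x, ∇ φ x⟫)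
        =ᵐ[vol Ω] fun x => c * ⟪u x, ∇ φ x⟫ := by
      filter_upwards [Lp.coeFn_smul c u] with x hx
      rw [hx, Pi.smul_apply, real_inner_smul_left]
    have a2 (φ : Space n → ℝ) : (fun x => (c • d : Lp ℝ 2 (vol Ω)) x * φ x)
        =ᵐ[vol Ω] fun x => c * (d x * φ x) := by
      filter_upwards [Lp.coeFn_smul c d] with x hx
      rw [hx, Pi.smul_apply, smul_eq_mul, mul_assoc]
    have a3 (φ : Space n → ℝ) : (fun x => (c • h : Lp ℝ 2 (surfOn Ω Γ)) x * φ x)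
        =ᵐ[surfOn Ω Γ] fun x => c * (h x * φ x) := by
      filter_upwards [Lp.coeFn_smul c h] with x hx
      rw [hx, Pi.smul_apply, smul_eq_mul, mul_assoc]
    refine ⟨fun φ hφ hs => ?_, fun v hv hs => ⟨?_, ?_⟩⟩
    · have e1 := hu φ hφ hs
      simp only at e1
      simp only [Prod.smul_mk]
      rw [integral_congr_ae (a1 φ), integral_congr_ae (a2 φ), integral_const_mul,
        integral_const_mul, e1, mul_neg]
    · exact ((hh v hv hs).1.const_mul c).congr (a3 v).symm
    · have e1 := (hh v hv hs).2
      simp only at e1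
      simp only [Prod.smul_mk]
      rw [integral_congr_ae (a3 v)]
      refine (integral_congr_ae ((a1 v).add (a2 v))).trans ?_
      rw [integral_const_mul,
        ← e1, ← integral_const_mul]
      refine integral_congr_ae (Eventually.of_forall fun x => ?_)
      simp only [Pi.add_apply]
      ring

/-- `g ∈ L²(∂Ω)` is the boundary trace of `p ∈ H¹(Ω)`: some sequence in `C^∞(ℝⁿ)` converges to `p`
in `H¹(Ω)` while its boundary values converge to `g` in `L²(∂Ω)`. -/
def IsTrace (Ω : Set (Space n)) (p : H1 Ω) (g : Lp ℝ 2 (surf Ω)) : Prop :=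
  ∃ φ : ℕ → Space n → ℝ, (∀ k, ContDiff ℝ ∞ (φ k)) ∧
    Tendsto (fun k => eLpNorm (fun x => φ k x - p.1.1 x) 2 (vol Ω)) atTop (𝓝 0) ∧
    Tendsto (fun k => eLpNorm (fun x => ∇ (φ k) x - p.1.2 x) 2 (vol Ω)) atTop (𝓝 0) ∧
    Tendsto (fun k => eLpNorm (fun x => φ k x - g x) 2 (surf Ω)) atTop (𝓝 0)

open Classical in
/-- The trace operator `H¹(Ω) → L²(∂Ω)`. (On a bounded Lipschitz set every `p ∈ H¹(Ω)` has exactly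
one trace, so that the value `0` in the other case plays no role.) -/
def trace (Ω : Set (Space n)) (p : H1 Ω) : Lp ℝ 2 (surf Ω) :=
  if h : ∃ g, IsTrace Ω p g then h.choose else 0

/-- The product space `𝒰 = H¹(Ω) × H(div; Ω, Γ)`, with elements `(p, u)`. -/
abbrev USpace (Ω Γ : Set (Space n)) : Type := H1 Ω × HDiv Ω Γ

section Components

variable {Ω Γ : Set (Space n)}

/-- The pressure component. -/
def USpace.pres (U : USpace Ω Γ) : Lp ℝ 2 (vol Ω) := U.1.1.1

/-- The gradient of the pressure component. -/
def USpace.gradPres (U : USpace Ω Γ) : Lp (Space n) 2 (vol Ω) := U.1.1.2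

/-- The velocity component. -/
def USpace.vel (U : USpace Ω Γ) : Lp (Space n) 2 (vol Ω) := U.2.1.1

/-- The divergence of the velocity component. -/
def USpace.divVel (U : USpace Ω Γ) : Lp ℝ 2 (vol Ω) := U.2.1.2.1

/-- The normal trace on `Γ` of the velocity component. -/
def USpace.normalVel (U : USpace Ω Γ) : Lp ℝ 2 (surfOn Ω Γ) := U.2.1.2.2

/-- The natural inner product of `𝒰`. -/
def innerU (W U : USpace Ω Γ) : ℝ :=
  (∫ x in Ω, W.pres x * U.pres x) + (∫ x in Ω, ⟪W.gradPres x, U.gradPres x⟫)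
    + (∫ x in Ω, ⟪W.vel x, U.vel x⟫) + (∫ x in Ω, W.divVel x * U.divVel x)
    + ∫ x, W.normalVel x * U.normalVel x ∂(surfOn Ω Γ)

/-- The associated norm of `𝒰`. -/
def normU (U : USpace Ω Γ) : ℝ := Real.sqrt (innerU U U)

end Components

/-- The `H¹(Ω)` norm. -/
def normH1 {Ω : Set (Space n)} (p : H1 Ω) : ℝ :=
  Real.sqrt ((∫ x in Ω, (p.1.1 x) ^ 2) + ∫ x in Ω, ‖p.1.2 x‖ ^ 2)

/-- The product of a matrix and a vector of `ℝⁿ`. -/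
def mulVecE (A : Matrix (Fin n) (Fin n) ℝ) (v : Space n) : Space n :=
  WithLp.toLp 2 (A.mulVec v.ofLp)

/-- The conditions on the permeability: entries in `L^∞(Ω)`, symmetric, and uniformly elliptic with
bounds `kmin` and `kmax`. -/
structure IsPermeability (Ω : Set (Space n)) (K : Space n → Matrix (Fin n) (Fin n) ℝ)
    (kmin kmax : ℝ) : Prop where
  bounded : ∀ i j, MemLp (fun x => K x i j) ∞ (vol Ω)
  symm : ∀ᵐ x ∂(vol Ω), (K x).IsSymm
  elliptic : ∀ᵐ x ∂(vol Ω), ∀ ξ : Space n,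
    kmin * ‖ξ‖ ^ 2 ≤ ⟪ξ, mulVecE (K x) ξ⟫ ∧ ⟪ξ, mulVecE (K x) ξ⟫ ≤ kmax * ‖ξ‖ ^ 2

/-- The flux residual `μ K⁻¹ u + grad p` at the point `x`. -/
def residual {Ω Γu : Set (Space n)} (μ : ℝ) (K : Space n → Matrix (Fin n) (Fin n) ℝ)
    (U : USpace Ω Γu) (x : Space n) : Space n :=
  μ • mulVecE (K x)⁻¹ (U.vel x) + U.gradPres x

/-- The least-squares bilinear form `𝓑(W; U)`. -/
def bilinB {Ω Γu : Set (Space n)} (Γp : Set (Space n)) (μ : ℝ)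
    (K : Space n → Matrix (Fin n) (Fin n) ℝ) (W U : USpace Ω Γu) : ℝ :=
  (∫ x in Ω, ⟪residual μ K W x, (1 / μ) • mulVecE (K x) (residual μ K U x)⟫)
    + (∫ x in Ω, W.divVel x * U.divVel x)
    + (∫ x, W.normalVel x * U.normalVel x ∂(surfOn Ω Γu))
    + ∫ x, trace Ω W.1 x * trace Ω U.1 x ∂(surfOn Ω Γp)

/-- `C` is a constant in the trace inequality `‖p‖_{L²(Γ)} ≤ C ‖p‖_{H¹(Ω)}`. -/
def IsTraceConst (Ω Γ : Set (Space n)) (C : ℝ) : Prop :=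
  0 < C ∧ ∀ p : H1 Ω,
    Real.sqrt (∫ x, (trace Ω p x) ^ 2 ∂(surfOn Ω Γ)) ≤ C * normH1 p

end LeastSquaresDarcy

end

/-!
The boundedness of `𝓑` is the Cauchy–Schwarz inequality, applied to each of the four terms.  In the
first term, ellipticity and symmetry give `‖K‖ ≤ kmax` (`norm_mulVecE_le`) and `‖K⁻¹‖ ≤ kmin⁻¹`
(`norm_mulVecE_inv_le`) at almost every point, whence the constant `C₁`
(`abs_integral_residual_le`).  The last term is bounded by the trace inequality.

The existence of a constant in the trace inequality is the substantial part.  Near a boundary point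
the boundary is a Lipschitz graph, on which surface measure is dominated by the push-forward of
Lebesgue measure of the base (`restrict_le_smul_map_graphPoint`).  A one-dimensional estimate along
the segments that enter `Ω` from the graph, integrated over the base by Fubini's theorem, bounds the
boundary values of a smooth function by its `H¹` norm
(`IsLipschitzEpigraphNear.exists_lintegral_le`), and finitely many such pieces cover the compact
boundary.

The inequality is transferred to `H¹(Ω)` by density: every `p ∈ H¹(Ω)` is a limit of functions
smooth up to the boundary (`IsBoundedLipschitz.exists_contDiff_tendsto`).  To see this, `p` is cut
by a smooth partition of unity, and each piece is mollified by a kernel supported in a cone of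
directions for which the value of the mollification at a point of `Ω` only involves values of `p`
inside `Ω`; the definition of the weak gradient, tested with the kernel itself, then shows that
gradients commute with the mollification.  By the trace inequality the boundary values of the
approximations are a Cauchy sequence in `L²(∂Ω)`, so every `p` has a trace
(`IsBoundedLipschitz.exists_isTrace`) and the inequality passes to the limit.
-/

namespace LeastSquaresDarcy

/-! ### The Cauchy–Schwarz inequality in `L²` -/

section LTwo

variable {X E F : Type*} [MeasurableSpace X] {m : Measure X}
  [NormedAddCommGroup E] [NormedAddCommGroup F]

theorem integrable_norm_mul_norm (f : Lp E 2 m) (g : Lp F 2 m) :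
    Integrable (fun x => ‖f x‖ * ‖g x‖) m :=
  (Lp.memLp f).norm.integrable_mul (Lp.memLp g).norm

theorem integral_norm_sq (f : Lp E 2 m) : ∫ x, ‖f x‖ ^ 2 ∂m = ‖f‖ ^ 2 := by
  rw [Lp.norm_def, (Lp.memLp f).eLpNorm_eq_integral_rpow_norm (by simp) (by simp),
    ENNReal.toReal_ofReal (by positivity), ← Real.rpow_mul_natCast (by positivity)]
  simp

theorem integral_norm_mul_norm_le (f : Lp E 2 m) (g : Lp F 2 m) :
    ∫ x, ‖f x‖ * ‖g x‖ ∂m ≤ ‖f‖ * ‖g‖ := by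
  have h := integral_mul_norm_le_Lp_mul_Lq (μ := m) Real.HolderConjugate.two_two
    (f := fun x => ‖f x‖) (g := fun x => ‖g x‖) (by simpa using (Lp.memLp f).norm)
    (by simpa using (Lp.memLp g).norm)
  simp only [norm_norm, Real.rpow_two, integral_norm_sq, ← Real.sqrt_eq_rpow] at h
  simpa [Real.sqrt_sq] using h

theorem abs_integral_mul_le (f g : Lp ℝ 2 m) : |∫ x, f x * g x ∂m| ≤ ‖f‖ * ‖g‖ := by
  refine (abs_integral_le_integral_abs).trans (le_trans (le_of_eq ?_)
    (integral_norm_mul_norm_le f g))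
  simp [abs_mul]

theorem integral_mul_self (f : Lp ℝ 2 m) : ∫ x, f x * f x ∂m = ‖f‖ ^ 2 := by
  rw [← integral_norm_sq]
  simp [sq]

end LTwo

/-! ### Bounds for elliptic matrices -/

variable {n : ℕ}

theorem inner_mulVecE (A : Matrix (Fin n) (Fin n) ℝ) (a b : Space n) :
    ⟪a, mulVecE A b⟫ = A.mulVec b.ofLp ⬝ᵥ a.ofLp := by
  simp [mulVecE, EuclideanSpace.inner_eq_star_dotProduct]

theorem mulVecE_add (A : Matrix (Fin n) (Fin n) ℝ) (a b : Space n) :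
    mulVecE A (a + b) = mulVecE A a + mulVecE A b := by
  simp [mulVecE, Matrix.mulVec_add]

theorem mulVecE_smul (A : Matrix (Fin n) (Fin n) ℝ) (c : ℝ) (a : Space n) :
    mulVecE A (c • a) = c • mulVecE A a := by
  simp [mulVecE, Matrix.mulVec_smul]

theorem inner_mulVecE_comm {A : Matrix (Fin n) (Fin n) ℝ} (hA : A.IsSymm) (a b : Space n) :
    ⟪a, mulVecE A b⟫ = ⟪b, mulVecE A a⟫ := by
  rw [inner_mulVecE, inner_mulVecE, dotProduct_comm, Matrix.dotProduct_mulVec,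
    ← Matrix.mulVec_transpose, hA.eq]

/-- A symmetric matrix whose quadratic form lies between `0` and `k ‖ξ‖²` has norm at most `k`. -/
theorem norm_mulVecE_le {A : Matrix (Fin n) (Fin n) ℝ} (hA : A.IsSymm) {k : ℝ} (hk : 0 < k)
    (h0 : ∀ ξ : Space n, 0 ≤ ⟪ξ, mulVecE A ξ⟫) (h1 : ∀ ξ : Space n, ⟪ξ, mulVecE A ξ⟫ ≤ k * ‖ξ‖ ^ 2)
    (ξ : Space n) : ‖mulVecE A ξ‖ ≤ k * ‖ξ‖ := by
  -- Polarization bounds `2 ⟪a, A b⟫` by `k (‖a‖² + ‖b‖²)`; for `a = A ξ` and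
  -- `b = k ξ` this reads `2 k ‖A ξ‖² ≤ k (‖A ξ‖² + k² ‖ξ‖²)`.
  have pol (a b : Space n) : 2 * ⟪a, mulVecE A b⟫ ≤ k * (‖a‖ ^ 2 + ‖b‖ ^ 2) := by
    have e1 := h1 (a + b)
    have e2 := h0 (a + (-1 : ℝ) • b)
    have e3 := h1 (a + (-1 : ℝ) • b)
    have e4 := h0 (a + b)
    have hn : ‖a + (-1 : ℝ) • b‖ ^ 2 = ‖a‖ ^ 2 - 2 * ⟪a, b⟫ + ‖b‖ ^ 2 := by
      rw [neg_one_smul, ← sub_eq_add_neg, norm_sub_sq_real]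
    rw [norm_add_sq_real] at e1
    simp only [mulVecE_add, mulVecE_smul, inner_add_left, inner_add_right, real_inner_smul_left,
      real_inner_smul_right, inner_mulVecE_comm hA b a] at e1 e2 e3 e4
    rw [hn] at e3
    nlinarith
  have h := pol (mulVecE A ξ) (k • ξ)
  rw [mulVecE_smul, real_inner_smul_right, real_inner_self_eq_norm_sq, norm_smul, mul_pow,
    Real.norm_eq_abs, sq_abs] at h
  have h' : ‖mulVecE A ξ‖ ^ 2 ≤ (k * ‖ξ‖) ^ 2 := by
    have : k * ‖mulVecE A ξ‖ ^ 2 ≤ k * (k * ‖ξ‖) ^ 2 := by nlinarith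
    exact le_of_mul_le_mul_left this hk
  exact abs_le_of_sq_le_sq' h' (by positivity) |>.2

theorem norm_mulVecE_inv_le {A : Matrix (Fin n) (Fin n) ℝ} {k : ℝ} (hk : 0 < k)
    (h0 : ∀ ξ : Space n, k * ‖ξ‖ ^ 2 ≤ ⟪ξ, mulVecE A ξ⟫) (v : Space n) :
    ‖mulVecE A⁻¹ v‖ ≤ k⁻¹ * ‖v‖ := by
  have hinj : Function.Injective A.mulVec := by
    intro a b hab
    have h1 : mulVecE A (WithLp.toLp 2 (a - b)) = 0 := by
      simp only [mulVecE, Matrix.mulVec_sub, hab, sub_self, WithLp.toLp_zero]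
    have h2 := h0 (WithLp.toLp 2 (a - b))
    rw [h1, inner_zero_right] at h2
    have h3 : ‖WithLp.toLp 2 (a - b)‖ ^ 2 ≤ 0 := by nlinarith
    have h4 : WithLp.toLp 2 (a - b) = 0 := by
      rw [← norm_eq_zero]; exact pow_eq_zero_iff two_ne_zero |>.1 (le_antisymm h3 (by positivity))
    have h5 : a - b = 0 := by simpa using congrArg WithLp.ofLp h4
    exact sub_eq_zero.1 h5
  have hu : IsUnit A := Matrix.mulVec_injective_iff_isUnit.1 hinj
  have hv : mulVecE A (mulVecE A⁻¹ v) = v := by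
    simp [mulVecE, Matrix.mulVec_mulVec,
      Matrix.mul_nonsing_inv _ ((Matrix.isUnit_iff_isUnit_det _).1 hu)]
  have h := h0 (mulVecE A⁻¹ v)
  rw [hv] at h
  have h2 := h.trans (real_inner_le_norm _ _)
  rw [inv_mul_eq_div, le_div_iff₀ hk]
  rcases (norm_nonneg (mulVecE A⁻¹ v)).eq_or_lt with h3 | h3
  · rw [← h3]; simp
  · refine le_of_mul_le_mul_left ?_ h3
    linarith [sq ‖mulVecE A⁻¹ v‖]

/-! ### Boundedness of the bilinear form -/

section Form

variable {Ω Γ : Set (Space n)}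

theorem normU_sq (U : USpace Ω Γ) : normU U ^ 2 =
    ‖U.pres‖ ^ 2 + ‖U.gradPres‖ ^ 2 + ‖U.vel‖ ^ 2 + ‖U.divVel‖ ^ 2 + ‖U.normalVel‖ ^ 2 := by
  have h : innerU U U =
      ‖U.pres‖ ^ 2 + ‖U.gradPres‖ ^ 2 + ‖U.vel‖ ^ 2 + ‖U.divVel‖ ^ 2 + ‖U.normalVel‖ ^ 2 := by
    simp only [innerU, integral_mul_self, real_inner_self_eq_norm_sq, integral_norm_sq]
  rw [normU, h, Real.sq_sqrt (by positivity)]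

theorem normU_nonneg (U : USpace Ω Γ) : 0 ≤ normU U := Real.sqrt_nonneg _

theorem norm_le_normU_of_sq_le {a : ℝ} {U : USpace Ω Γ} (h : a ^ 2 ≤ ‖U.pres‖ ^ 2 +
    ‖U.gradPres‖ ^ 2 + ‖U.vel‖ ^ 2 + ‖U.divVel‖ ^ 2 + ‖U.normalVel‖ ^ 2) : a ≤ normU U :=
  (abs_le_of_sq_le_sq' (h.trans (normU_sq U).ge) (normU_nonneg U)).2

theorem norm_gradPres_le (U : USpace Ω Γ) : ‖U.gradPres‖ ≤ normU U :=
  norm_le_normU_of_sq_le (by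
    linarith [sq_nonneg (‖U.pres‖), sq_nonneg (‖U.vel‖),
      sq_nonneg (‖U.divVel‖),
      sq_nonneg (‖U.normalVel‖)])

theorem norm_vel_le (U : USpace Ω Γ) : ‖U.vel‖ ≤ normU U :=
  norm_le_normU_of_sq_le (by
    linarith [sq_nonneg (‖U.pres‖), sq_nonneg (‖U.gradPres‖),
      sq_nonneg (‖U.divVel‖),
      sq_nonneg (‖U.normalVel‖)])

theorem norm_divVel_le (U : USpace Ω Γ) : ‖U.divVel‖ ≤ normU U :=
  norm_le_normU_of_sq_le (by
    linarith [sq_nonneg (‖U.pres‖), sq_nonneg (‖U.gradPres‖),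
      sq_nonneg (‖U.vel‖),
      sq_nonneg (‖U.normalVel‖)])

theorem norm_normalVel_le (U : USpace Ω Γ) : ‖U.normalVel‖ ≤ normU U :=
  norm_le_normU_of_sq_le (by
    linarith [sq_nonneg (‖U.pres‖), sq_nonneg (‖U.gradPres‖),
      sq_nonneg (‖U.vel‖),
      sq_nonneg (‖U.divVel‖)])

theorem normH1_eq (p : H1 Ω) : normH1 p = Real.sqrt (‖p.1.1‖ ^ 2 + ‖p.1.2‖ ^ 2) := by
  have h : ∫ x in Ω, (p.1.1 x) ^ 2 = ‖p.1.1‖ ^ 2 := by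
    rw [← integral_mul_self]; simp only [sq]
  rw [normH1, integral_norm_sq, h]

theorem normH1_le_normU (U : USpace Ω Γ) : normH1 U.1 ≤ normU U := by
  rw [normH1_eq, Real.sqrt_le_left (normU_nonneg U), normU_sq]
  change ‖U.pres‖ ^ 2 + ‖U.gradPres‖ ^ 2 ≤ _
  nlinarith only [sq_nonneg (‖U.vel‖), sq_nonneg (‖U.divVel‖), sq_nonneg (‖U.normalVel‖)]

/-- The volume term of the flux residuals.  The pointwise bound needs only `‖K‖ ≤ kmax` and
`‖K⁻¹‖ ≤ kmin⁻¹`; the four products that it produces are estimated in `L²`. -/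
theorem abs_integral_residual_le {μ kmin kmax : ℝ} (hμ : 0 < μ) (hmin : 0 < kmin)
    (hle : kmin ≤ kmax) {K : Space n → Matrix (Fin n) (Fin n) ℝ}
    (hK : IsPermeability Ω K kmin kmax) (W U : USpace Ω Γ) :
    |∫ x in Ω, ⟪residual μ K W x, (1 / μ) • mulVecE (K x) (residual μ K U x)⟫| ≤
      kmax / μ * (μ * kmin⁻¹ + 1) ^ 2 * (normU W * normU U) := by
  have hmax : 0 < kmax := hmin.trans_le hle
  set c := μ * kmin⁻¹ with hc
  have hc0 : 0 < c := by positivity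
  have i1 := (integrable_norm_mul_norm W.vel U.vel).const_mul (c ^ 2)
  have i2 := (integrable_norm_mul_norm W.vel U.gradPres).const_mul c
  have i3 := (integrable_norm_mul_norm W.gradPres U.vel).const_mul c
  have i4 := integrable_norm_mul_norm W.gradPres U.gradPres
  have hb : ∀ᵐ x ∂(vol Ω),
      ‖⟪residual μ K W x, (1 / μ) • mulVecE (K x) (residual μ K U x)⟫‖ ≤
      kmax / μ * ((c ^ 2 * (‖W.vel x‖ * ‖U.vel x‖) + c * (‖W.vel x‖ * ‖U.gradPres x‖))
        + (c * (‖W.gradPres x‖ * ‖U.vel x‖) + ‖W.gradPres x‖ * ‖U.gradPres x‖)) := by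
    filter_upwards [hK.symm, hK.elliptic] with x hs he
    have hpos (ξ : Space n) : 0 ≤ ⟪ξ, mulVecE (K x) ξ⟫ := le_trans (by positivity) (he ξ).1
    have hr (V : USpace Ω Γ) : ‖residual μ K V x‖ ≤ c * ‖V.vel x‖ + ‖V.gradPres x‖ := by
      refine (norm_add_le _ _).trans (add_le_add_left ?_ _)
      rw [norm_smul, Real.norm_of_nonneg hμ.le, hc, mul_assoc]
      exact mul_le_mul_of_nonneg_left (norm_mulVecE_inv_le hmin (fun ξ => (he ξ).1) _) hμ.le
    calc _ ≤ ‖residual μ K W x‖ * ‖(1 / μ) • mulVecE (K x) (residual μ K U x)‖ :=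
          norm_inner_le_norm _ _
      _ ≤ (c * ‖W.vel x‖ + ‖W.gradPres x‖) *
          (1 / μ * (kmax * (c * ‖U.vel x‖ + ‖U.gradPres x‖))) := by
          rw [norm_smul, Real.norm_of_nonneg (by positivity)]
          refine mul_le_mul (hr W) (mul_le_mul_of_nonneg_left ?_ (by positivity)) (by positivity)
            (by positivity)
          exact (norm_mulVecE_le hs hmax hpos (fun ξ => (he ξ).2) _).trans
            (mul_le_mul_of_nonneg_left (hr U) hmax.le)
      _ = _ := by ring
  have hi := ((i1.add i2).add (i3.add i4)).const_mul (kmax / μ)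
  have hint := norm_integral_le_of_norm_le hi hb
  rw [Real.norm_eq_abs] at hint
  refine hint.trans ?_
  rw [integral_const_mul, integral_add' (i1.add i2) (i3.add i4), integral_add' i1 i2,
    integral_add' i3 i4, integral_const_mul, integral_const_mul, integral_const_mul,
    mul_assoc (kmax / μ)]
  refine mul_le_mul_of_nonneg_left ?_ (by positivity)
  have hW := normU_nonneg W
  have j {E F : Type} [NormedAddCommGroup E] [NormedAddCommGroup F] (f : Lp E 2 (vol Ω))
      (g : Lp F 2 (vol Ω)) (hf : ‖f‖ ≤ normU W) (hg : ‖g‖ ≤ normU U) :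
      ∫ x in Ω, ‖f x‖ * ‖g x‖ ≤ normU W * normU U :=
    (integral_norm_mul_norm_le f g).trans (mul_le_mul hf hg (norm_nonneg _) hW)
  have j1 := j W.vel U.vel (norm_vel_le W) (norm_vel_le U)
  have j2 := j W.vel U.gradPres (norm_vel_le W) (norm_gradPres_le U)
  have j3 := j W.gradPres U.vel (norm_gradPres_le W) (norm_vel_le U)
  have j4 := j W.gradPres U.gradPres (norm_gradPres_le W) (norm_gradPres_le U)
  nlinarith [mul_le_mul_of_nonneg_left j1 (sq_nonneg c), mul_le_mul_of_nonneg_left j2 hc0.le,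
    mul_le_mul_of_nonneg_left j3 hc0.le]

/-- The boundary term on `Γp`, in terms of any constant of the trace inequality. -/
theorem abs_integral_trace_le {Γp : Set (Space n)} {C : ℝ} (hC : IsTraceConst Ω Γp C)
    (W U : USpace Ω Γ) :
    |∫ x, trace Ω W.1 x * trace Ω U.1 x ∂(surfOn Ω Γp)| ≤ C ^ 2 * (normU W * normU U) := by
  have hm (V : USpace Ω Γ) : MemLp (trace Ω V.1) 2 (surfOn Ω Γp) :=
    (Lp.memLp (trace Ω V.1)).restrict Γp
  have hn (V : USpace Ω Γ) : ‖(hm V).toLp‖ ≤ C * normU V := by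
    have h : Real.sqrt (∫ x, (trace Ω V.1 x) ^ 2 ∂(surfOn Ω Γp)) = ‖(hm V).toLp‖ := by
      rw [← Real.sqrt_sq (norm_nonneg (hm V).toLp), ← integral_mul_self]
      congr 1
      refine integral_congr_ae ?_
      filter_upwards [(hm V).coeFn_toLp] with x hx
      rw [hx, sq]
    rw [← h]
    exact (hC.2 V.1).trans (mul_le_mul_of_nonneg_left (normH1_le_normU V) hC.1.le)
  have h : ∫ x, trace Ω W.1 x * trace Ω U.1 x ∂(surfOn Ω Γp) =
      ∫ x, (hm W).toLp _ x * (hm U).toLp _ x ∂(surfOn Ω Γp) := by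
    refine integral_congr_ae ?_
    filter_upwards [(hm W).coeFn_toLp, (hm U).coeFn_toLp] with x h1 h2
    rw [h1, h2]
  rw [h]
  refine (abs_integral_mul_le _ _).trans ((mul_le_mul (hn W) (hn U) (norm_nonneg _)
    (mul_nonneg hC.1.le (normU_nonneg W))).trans (le_of_eq (by ring)))

theorem abs_bilinB_le {Γp : Set (Space n)} {C μ kmin kmax : ℝ} (hC : IsTraceConst Ω Γp C)
    (hμ : 0 < μ) (hmin : 0 < kmin) (hle : kmin ≤ kmax)
    {K : Space n → Matrix (Fin n) (Fin n) ℝ} (hK : IsPermeability Ω K kmin kmax)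
    (W U : USpace Ω Γ) :
    |bilinB Γp μ K W U| ≤
      (kmax / μ * (μ * kmin⁻¹ + 1) ^ 2 + 2 + C ^ 2) * normU W * normU U := by
  have h1 := abs_integral_residual_le hμ hmin hle hK W U
  have h2 := (abs_integral_mul_le W.divVel U.divVel).trans
    (mul_le_mul (norm_divVel_le W) (norm_divVel_le U) (norm_nonneg _) (normU_nonneg W))
  have h3 := (abs_integral_mul_le W.normalVel U.normalVel).trans
    (mul_le_mul (norm_normalVel_le W) (norm_normalVel_le U) (norm_nonneg _) (normU_nonneg W))
  have h4 := abs_integral_trace_le hC W U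
  rw [bilinB]
  refine (abs_add_le _ _).trans ((add_le_add ((abs_add_le _ _).trans
    (add_le_add ((abs_add_le _ _).trans (add_le_add h1 h2)) h3)) h4).trans (le_of_eq (by ring)))

end Form

end LeastSquaresDarcy

/-! ### The trace inequality for smooth functions -/

namespace LeastSquaresDarcy

variable {n : ℕ}

/-- The point of the graph of `γ` over `z`, the graph being taken in the direction `ν`. -/
noncomputable def graphPoint (ν : Space n) (γ : (ℝ ∙ ν)ᗮ → ℝ) (z : (ℝ ∙ ν)ᗮ) : Space n :=
  (z : Space n) + γ z • ν

theorem lipschitzWith_graphPoint {ν : Space n} (hν : ‖ν‖ = 1) {γ : (ℝ ∙ ν)ᗮ → ℝ} {L : NNReal}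
    (hγ : LipschitzWith L γ) : LipschitzWith (1 + L) (graphPoint ν γ) := by
  refine LipschitzWith.of_dist_le_mul fun a b => ?_
  have h1 : graphPoint ν γ a - graphPoint ν γ b = ((a - b : (ℝ ∙ ν)ᗮ) : Space n)
      + (γ a - γ b) • ν := by
    simp only [graphPoint, Submodule.coe_sub, sub_smul]; abel
  have h2 := hγ.dist_le_mul a b
  rw [Real.dist_eq] at h2
  rw [dist_eq_norm, h1]
  refine (norm_add_le _ _).trans ?_
  rw [norm_smul, hν, mul_one, Real.norm_eq_abs, Submodule.norm_coe, ← dist_eq_norm]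
  push_cast
  linarith

theorem inner_coe_orthogonal_eq_zero {ν : Space n} (z : (ℝ ∙ ν)ᗮ) : ⟪ν, (z : Space n)⟫ = 0 :=
  Submodule.mem_orthogonal_singleton_iff_inner_right.1 z.2

theorem inner_add_smul {ν : Space n} (hν : ‖ν‖ = 1) (z : (ℝ ∙ ν)ᗮ) (t : ℝ) :
    ⟪ν, (z : Space n) + t • ν⟫ = t := by
  rw [inner_add_right, inner_coe_orthogonal_eq_zero, real_inner_smul_right,
    real_inner_self_eq_norm_sq, hν]
  simp

theorem orthogonalProjectionOnto_add_smul (ν : Space n) (z : (ℝ ∙ ν)ᗮ) (t : ℝ) :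
    (ℝ ∙ ν)ᗮ.orthogonalProjectionOnto ((z : Space n) + t • ν) = z := by
  rw [map_add, Submodule.orthogonalProjectionOnto_mem_subspace_eq_self,
    map_smul, Submodule.orthogonalProjectionOnto_orthogonal_apply_eq_zero
      (Submodule.mem_span_singleton_self ν), smul_zero, add_zero]

theorem orthogonalProjectionOnto_add_inner_smul {ν : Space n} (hν : ‖ν‖ = 1) (y : Space n) :
    ((ℝ ∙ ν)ᗮ.orthogonalProjectionOnto y : Space n) + ⟪ν, y⟫ • ν = y := by
  have h := (ℝ ∙ ν).starProjection_add_starProjection_orthogonal y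
  rw [Submodule.starProjection_unit_singleton ℝ hν, add_comm] at h
  exact h

theorem frontier_subset_graph {Ω : Set (Space n)} (hΩ : IsOpen Ω) {ν : Space n} (hν : ‖ν‖ = 1)
    {γ : (ℝ ∙ ν)ᗮ → ℝ} (hγ : Continuous γ) {x : Space n} {r : ℝ}
    (h : ∀ y ∈ Metric.ball x r, y ∈ Ω ↔ γ ((ℝ ∙ ν)ᗮ.orthogonalProjectionOnto y) < ⟪ν, y⟫)
    {y : Space n} (hy : y ∈ frontier Ω) (hyr : y ∈ Metric.ball x r) :
    graphPoint ν γ ((ℝ ∙ ν)ᗮ.orthogonalProjectionOnto y) = y := by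
  have h1 : ⟪ν, y⟫ ≤ γ ((ℝ ∙ ν)ᗮ.orthogonalProjectionOnto y) := by
    rw [← not_lt, ← h y hyr]
    rw [hΩ.frontier_eq] at hy
    exact hy.2
  have h2 : γ ((ℝ ∙ ν)ᗮ.orthogonalProjectionOnto y) ≤ ⟪ν, y⟫ := by
    by_contra! hlt
    have ho : IsOpen {w | ⟪ν, w⟫ < γ ((ℝ ∙ ν)ᗮ.orthogonalProjectionOnto w)} :=
      isOpen_lt (by fun_prop) (by fun_prop)
    obtain ⟨w, ⟨hw1, hw2⟩, hw3⟩ := mem_closure_iff.1 (frontier_subset_closure hy) _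
      (ho.inter Metric.isOpen_ball) ⟨hlt, hyr⟩
    exact lt_asymm hw1 ((h w hw2).1 hw3)
  rw [graphPoint, le_antisymm h2 h1, orthogonalProjectionOnto_add_inner_smul hν]

/-- Surface measure on a Lipschitz graph is dominated by Lebesgue measure on the base of the graph,
because the graph is the image of its base under a Lipschitz map. -/
theorem restrict_le_smul_map_graphPoint {ν : Space n} (hν : ‖ν‖ = 1) {γ : (ℝ ∙ ν)ᗮ → ℝ}
    {L : NNReal} (hγ : LipschitzWith L γ) {s : Set (Space n)}
    (hs : ∀ y ∈ s, graphPoint ν γ ((ℝ ∙ ν)ᗮ.orthogonalProjectionOnto y) = y) :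
    (μHE[n - 1] : Measure (Space n)).restrict s ≤
      (((1 + L) ^ (n - 1) : NNReal) : ℝ≥0∞) • (volume : Measure (ℝ ∙ ν)ᗮ).map (graphPoint ν γ) := by
  have hG := lipschitzWith_graphPoint hν hγ
  have hfin : Module.finrank ℝ (ℝ ∙ ν)ᗮ = n - 1 := by
    have h := (ℝ ∙ ν).finrank_add_finrank_orthogonal
    rw [finrank_span_singleton (by rintro rfl; simp at hν), finrank_euclideanSpace_fin] at h
    omega
  have hvol : (μHE[n - 1] : Measure (ℝ ∙ ν)ᗮ) = volume := by
    rw [← hfin, InnerProductSpace.euclideanHausdorffMeasure_eq_volume]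
  refine Measure.le_iff.2 fun A hA => ?_
  rw [Measure.restrict_apply hA, Measure.smul_apply, Measure.map_apply hG.continuous.measurable hA,
    smul_eq_mul]
  have hsub : A ∩ s ⊆ graphPoint ν γ '' (graphPoint ν γ ⁻¹' A) := by
    rintro y ⟨hyA, hys⟩
    exact ⟨(ℝ ∙ ν)ᗮ.orthogonalProjectionOnto y, by simpa [hs y hys] using hyA, hs y hys⟩
  refine (measure_mono hsub).trans ?_
  rw [← hvol, Measure.euclideanHausdorffMeasure_def, Measure.euclideanHausdorffMeasure_def,
    Measure.smul_apply, Measure.smul_apply, ENNReal.smul_def, ENNReal.smul_def, smul_eq_mul,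
    smul_eq_mul, mul_left_comm]
  gcongr
  have h := hG.hausdorffMeasure_image_le (d := (n - 1 : ℕ)) (by positivity) (graphPoint ν γ ⁻¹' A)
  simpa using h

/-- Fubini's theorem in the coordinates given by the lines in the direction `ν`, measured from the
graph of `γ`. -/
theorem lintegral_graphPoint_add {ν : Space n} (hν : ‖ν‖ = 1) (γ : (ℝ ∙ ν)ᗮ → ℝ)
    {F : Space n → ℝ≥0∞} (hF : Measurable F) :
    ∫⁻ z : (ℝ ∙ ν)ᗮ, ∫⁻ s : ℝ, F (graphPoint ν γ z + s • ν) = ∫⁻ y, F y := by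
  have hmp := ((ℝ ∙ ν).measurePreserving_measurableEquivProd (0 : Space n)).symm
  rw [InnerProductSpace.euclideanHausdorffMeasure_eq_volume] at hmp
  have hFm := hF.comp hmp.measurable
  rw [← hmp.lintegral_comp hF, Measure.volume_eq_prod]
  refine Eq.trans ?_ (lintegral_prod_symm' _ hFm).symm
  refine lintegral_congr fun z => ?_
  have he := (LinearIsometryEquiv.toSpanUnitSingleton (𝕜 := ℝ) ν hν).measurePreserving
  have hFz : Measurable fun a => (F ∘ ((ℝ ∙ ν).measurableEquivProd (0 : Space n)).symm) (a, z) :=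
    hFm.comp (by fun_prop)
  rw [← he.lintegral_comp hFz]
  refine Eq.trans ?_ (lintegral_add_left_eq_self (μ := volume) _ (γ z))
  refine lintegral_congr fun s => ?_
  congr 1
  simp only [graphPoint, Submodule.measurableEquivProd_symm_apply,
    LinearIsometryEquiv.toSpanUnitSingleton_apply, vadd_eq_add, add_zero, add_smul]
  abel

/-- The one-dimensional trace inequality: `g(0)² = g(s)² - ∫₀ˢ 2 g g'` is averaged over
`s ∈ (0, h)`. -/
theorem sq_zero_le_integral {g g' : ℝ → ℝ} (hg : ∀ t, HasDerivAt g (g' t) t) (hg' : Continuous g')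
    {h : ℝ} (hh : 0 < h) :
    g 0 ^ 2 ≤ (1 / h + 1) * ∫ t in (0 : ℝ)..h, (g t ^ 2 + g' t ^ 2) := by
  have hc : Continuous g := continuous_iff_continuousAt.2 fun t => (hg t).continuousAt
  set M := ∫ t in (0 : ℝ)..h, (g t ^ 2 + g' t ^ 2) with hM
  have hI (a b : ℝ) : IntervalIntegrable (fun t => g t ^ 2 + g' t ^ 2) volume a b :=
    Continuous.intervalIntegrable (by fun_prop) a b
  have key (s : ℝ) (hs : s ∈ Set.Icc 0 h) : g 0 ^ 2 ≤ g s ^ 2 + M := by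
    have e : ∫ t in (0 : ℝ)..s, -(2 * g t * g' t) = g 0 ^ 2 - g s ^ 2 := by
      rw [intervalIntegral.integral_neg, intervalIntegral.integral_eq_sub_of_hasDerivAt
        (f := fun t => g t ^ 2) (fun t _ => by simpa using (hg t).fun_pow 2)
        (Continuous.intervalIntegrable (by fun_prop) _ _)]
      ring
    have l1 : ∫ t in (0 : ℝ)..s, -(2 * g t * g' t) ≤ ∫ t in (0 : ℝ)..s, (g t ^ 2 + g' t ^ 2) :=
      intervalIntegral.integral_mono_on hs.1 (Continuous.intervalIntegrable (by fun_prop) _ _)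
        (hI _ _) fun t _ => by nlinarith [sq_nonneg (g t + g' t)]
    have l2 : ∫ t in (0 : ℝ)..s, (g t ^ 2 + g' t ^ 2) ≤ M :=
      intervalIntegral.integral_mono_interval le_rfl hs.1 hs.2
        (Eventually.of_forall fun t => by positivity) (hI _ _)
    linarith
  have l3 : ∫ _ in (0 : ℝ)..h, g 0 ^ 2 ≤ ∫ s in (0 : ℝ)..h, (g s ^ 2 + M) :=
    intervalIntegral.integral_mono_on hh.le (by simp)
      (Continuous.intervalIntegrable (by fun_prop) _ _) key
  have l4 : ∫ s in (0 : ℝ)..h, g s ^ 2 ≤ M :=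
    intervalIntegral.integral_mono_on hh.le (Continuous.intervalIntegrable (by fun_prop) _ _)
      (hI _ _) fun t _ => by nlinarith [sq_nonneg (g' t)]
  rw [intervalIntegral.integral_add (Continuous.intervalIntegrable (by fun_prop) _ _) (by simp)]
    at l3
  simp only [intervalIntegral.integral_const, sub_zero, smul_eq_mul] at l3
  have : g 0 ^ 2 ≤ (M + h * M) / h := by
    rw [le_div_iff₀ hh]; linarith
  refine this.trans (le_of_eq ?_)
  field_simp

/-- The energy density `|φ|² + |∇φ|²`. -/
noncomputable def energy (φ : Space n → ℝ) (x : Space n) : ℝ≥0∞ := ‖φ x‖ₑ ^ 2 + ‖∇ φ x‖ₑ ^ 2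

theorem continuous_gradient {φ : Space n → ℝ} (hφ : ContDiff ℝ ∞ φ) : Continuous (∇ φ) :=
  (InnerProductSpace.toDual ℝ (Space n)).symm.continuous.comp (hφ.continuous_fderiv (by simp))

theorem measurable_energy {φ : Space n → ℝ} (hφ : ContDiff ℝ ∞ φ) : Measurable (energy φ) := by
  have h1 := hφ.continuous
  have h2 := continuous_gradient hφ
  unfold energy
  fun_prop

/-- The one-dimensional trace inequality along the segment from `y` to `y + h ν`. -/
theorem enorm_sq_le_lintegral_energy {φ : Space n → ℝ} (hφ : ContDiff ℝ ∞ φ) {ν : Space n}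
    (hν : ‖ν‖ = 1) (y : Space n) {h : ℝ} (hh : 0 < h) :
    ‖φ y‖ₑ ^ 2 ≤ ENNReal.ofReal (1 / h + 1) * ∫⁻ s in Set.Ioo 0 h, energy φ (y + s • ν) := by
  have hg (t : ℝ) : HasDerivAt (fun s : ℝ => φ (y + s • ν)) ⟪∇ φ (y + t • ν), ν⟫ t := by
    have h1 := (hφ.differentiable (by simp) (y + t • ν)).hasGradientAt.hasFDerivAt
    have h2 : HasDerivAt (fun s : ℝ => y + s • ν) ν t := by
      simpa using ((hasDerivAt_id t).smul_const ν).const_add y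
    have h3 := h1.comp_hasDerivAt t h2
    rw [InnerProductSpace.toDual_apply_apply] at h3
    exact h3
  have hcg := continuous_gradient hφ
  have hc := hφ.continuous
  have key := sq_zero_le_integral hg (by fun_prop) hh
  simp only [zero_smul, add_zero] at key
  have e1 : ‖φ y‖ₑ ^ 2 = ENNReal.ofReal (φ y ^ 2) := by
    rw [← sq_abs, ENNReal.ofReal_pow (abs_nonneg _), ← Real.norm_eq_abs, ofReal_norm]
  rw [e1]
  refine (ENNReal.ofReal_le_ofReal key).trans ?_
  rw [ENNReal.ofReal_mul (by positivity)]
  gcongr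
  rw [intervalIntegral.integral_of_le hh.le, integral_Ioc_eq_integral_Ioo,
    ofReal_integral_eq_lintegral_ofReal]
  · refine lintegral_mono fun s => ?_
    rw [ENNReal.ofReal_add (by positivity) (by positivity), energy]
    gcongr
    · rw [← sq_abs, ENNReal.ofReal_pow (abs_nonneg _), ← Real.norm_eq_abs, ofReal_norm]
    · rw [← ofReal_norm, ← ENNReal.ofReal_pow (norm_nonneg _)]
      refine ENNReal.ofReal_le_ofReal ?_
      have := abs_real_inner_le_norm (∇ φ (y + s • ν)) ν
      rw [hν, mul_one] at this
      rw [← sq_abs]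
      gcongr
  · exact (Continuous.integrableOn_Icc (by fun_prop)).mono_set Set.Ioo_subset_Icc_self
  · exact Eventually.of_forall fun s => by positivity

/-- The trace inequality on the part of the boundary near one of its points. -/
theorem IsLipschitzEpigraphNear.exists_lintegral_le {Ω : Set (Space n)} (hΩ : IsOpen Ω)
    {x : Space n} (hx : IsLipschitzEpigraphNear Ω x) :
    ∃ ρ > 0, ∃ C : NNReal, ∀ φ : Space n → ℝ, ContDiff ℝ ∞ φ →
      ∫⁻ y in frontier Ω ∩ Metric.ball x ρ, ‖φ y‖ₑ ^ 2 ∂μHE[n - 1] ≤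
        C * ∫⁻ y in Ω, energy φ y := by
  obtain ⟨ν, γ, L, r, hν, hγ, hr, h⟩ := hx
  -- Segments of length `r / 2` that start on the graph inside the ball of radius `r / 2` stay in
  -- the ball of radius `r`, where `Ω` is known to be the epigraph.
  have hG := lipschitzWith_graphPoint hν hγ
  refine ⟨r / 2, by positivity, (1 + L) ^ (n - 1) * Real.toNNReal (1 / (r / 2) + 1),
    fun φ hφ => ?_⟩
  have hφc := hφ.continuous
  set B := Metric.ball x (r / 2) with hB
  have hBr : B ⊆ Metric.ball x r := Metric.ball_subset_ball (by linarith)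
  have hm : Measurable (B.indicator fun y => ‖φ y‖ₑ ^ 2) :=
    Measurable.indicator (by fun_prop) measurableSet_ball
  have hFm : Measurable (Ω.indicator (energy φ)) :=
    (measurable_energy hφ).indicator hΩ.measurableSet
  have step (z : (ℝ ∙ ν)ᗮ) : B.indicator (fun y => ‖φ y‖ₑ ^ 2) (graphPoint ν γ z) ≤
      ENNReal.ofReal (1 / (r / 2) + 1) *
        ∫⁻ s : ℝ, Ω.indicator (energy φ) (graphPoint ν γ z + s • ν) := by
    by_cases hz : graphPoint ν γ z ∈ B
    · rw [Set.indicator_of_mem hz]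
      refine (enorm_sq_le_lintegral_energy hφ hν _ (half_pos hr)).trans ?_
      refine mul_le_mul_right ?_ _
      rw [← lintegral_indicator measurableSet_Ioo]
      refine lintegral_mono fun s => ?_
      by_cases hs : s ∈ Set.Ioo 0 (r / 2)
      · have hmem : graphPoint ν γ z + s • ν ∈ Ω := by
          have he : graphPoint ν γ z + s • ν = (z : Space n) + (γ z + s) • ν := by
            rw [graphPoint, add_smul, add_assoc]
          have hb : graphPoint ν γ z + s • ν ∈ Metric.ball x r := by
            rw [Metric.mem_ball, dist_eq_norm]
            rw [hB, Metric.mem_ball, dist_eq_norm] at hz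
            have : graphPoint ν γ z + s • ν - x = (graphPoint ν γ z - x) + s • ν := by abel
            rw [this]
            refine (norm_add_le _ _).trans_lt ?_
            rw [norm_smul, hν, mul_one, Real.norm_of_nonneg hs.1.le]
            linarith [hs.2]
          rw [h _ hb, he, orthogonalProjectionOnto_add_smul, inner_add_smul hν]
          linarith [hs.1]
        rw [Set.indicator_of_mem hs, Set.indicator_of_mem hmem]
      · rw [Set.indicator_of_notMem hs]
        exact zero_le
    · rw [Set.indicator_of_notMem hz]
      exact zero_le
  calc ∫⁻ y in frontier Ω ∩ B, ‖φ y‖ₑ ^ 2 ∂μHE[n - 1]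
      = ∫⁻ y in frontier Ω ∩ B, B.indicator (fun y => ‖φ y‖ₑ ^ 2) y ∂μHE[n - 1] := by
        refine setLIntegral_congr_fun (measurableSet_frontier.inter measurableSet_ball)
          fun y hy => ?_
        simp only [Set.indicator_of_mem hy.2]
    _ ≤ ∫⁻ y, B.indicator (fun y => ‖φ y‖ₑ ^ 2) y ∂((((1 + L) ^ (n - 1) : NNReal) : ℝ≥0∞) •
          (volume : Measure (ℝ ∙ ν)ᗮ).map (graphPoint ν γ)) :=
        lintegral_mono' (restrict_le_smul_map_graphPoint hν hγ fun y hy =>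
          frontier_subset_graph hΩ hν hγ.continuous h hy.1 (hBr hy.2)) le_rfl
    _ = (((1 + L) ^ (n - 1) : NNReal) : ℝ≥0∞) *
          ∫⁻ z, B.indicator (fun y => ‖φ y‖ₑ ^ 2) (graphPoint ν γ z) := by
        rw [lintegral_smul_measure, lintegral_map hm hG.continuous.measurable, smul_eq_mul]
    _ ≤ (((1 + L) ^ (n - 1) : NNReal) : ℝ≥0∞) * ∫⁻ z, ENNReal.ofReal (1 / (r / 2) + 1) *
          ∫⁻ s : ℝ, Ω.indicator (energy φ) (graphPoint ν γ z + s • ν) := by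
        gcongr with z
        exact step z
    _ = _ := by
        rw [lintegral_const_mul' _ _ (by simp), lintegral_graphPoint_add hν γ hFm,
          lintegral_indicator hΩ.measurableSet, ENNReal.coe_mul, mul_assoc]
        rfl

/-- The trace inequality for smooth functions, from a finite cover of the boundary. -/
theorem IsBoundedLipschitz.exists_lintegral_surf_le {Ω : Set (Space n)}
    (hΩ : IsBoundedLipschitz Ω) :
    ∃ C : NNReal, ∀ φ : Space n → ℝ, ContDiff ℝ ∞ φ →
      ∫⁻ y, ‖φ y‖ₑ ^ 2 ∂(surf Ω) ≤ C * ∫⁻ y in Ω, energy φ y := by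
  have hcpt : IsCompact (frontier Ω) :=
    Metric.isCompact_of_isClosed_isBounded isClosed_frontier
      (hΩ.isBounded.closure.subset frontier_subset_closure)
  refine hcpt.induction_on (p := fun s => ∃ C : NNReal, ∀ φ : Space n → ℝ, ContDiff ℝ ∞ φ →
      ∫⁻ y in s, ‖φ y‖ₑ ^ 2 ∂μHE[n - 1] ≤ C * ∫⁻ y in Ω, energy φ y) ?_ ?_ ?_ ?_
  · exact ⟨0, by simp⟩
  · rintro s t hst ⟨C, hC⟩
    exact ⟨C, fun φ hφ => (lintegral_mono_set hst).trans (hC φ hφ)⟩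
  · rintro s t ⟨C, hC⟩ ⟨D, hD⟩
    refine ⟨C + D, fun φ hφ => (lintegral_union_le _ _ _).trans ?_⟩
    rw [ENNReal.coe_add, add_mul]
    exact add_le_add (hC φ hφ) (hD φ hφ)
  · intro x hx
    obtain ⟨ρ, hρ, C, hC⟩ := (hΩ.lipschitz x hx).exists_lintegral_le hΩ.isOpen
    refine ⟨frontier Ω ∩ Metric.ball x ρ, ?_, C, hC⟩
    exact inter_mem self_mem_nhdsWithin (mem_nhdsWithin_of_mem_nhds (Metric.ball_mem_nhds x hρ))

end LeastSquaresDarcy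

/-! ### Mollification in `L²` -/

namespace LeastSquaresDarcy

variable {n : ℕ} {F : Type*} [NormedAddCommGroup F]

/-- Translations act continuously on `L²`. -/
theorem tendsto_eLpNorm_translate_sub {f : Space n → F} (hf : MemLp f 2 volume) :
    Tendsto (fun t : Space n => eLpNorm (fun x => f (x - t) - f x) 2 volume) (𝓝 0) (𝓝 0) := by
  let τ : Space n → C(Space n, Space n) :=
    ContinuousMap.curry ⟨fun q : Space n × Space n => q.2 - q.1, by fun_prop⟩
  have hτ : Continuous τ := ContinuousMap.continuous _
  have hmp (t : Space n) : MeasurePreserving (τ t) volume volume := measurePreserving_sub_right _ t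
  have hc : Continuous fun t => Lp.compMeasurePreserving (τ t) (hmp t) hf.toLp :=
    (continuous_const (y := hf.toLp)).compMeasurePreservingLp hτ hmp (by simp)
  have h := (hc.tendsto 0).sub_const hf.toLp
  have h0 : Lp.compMeasurePreserving (τ 0) (hmp 0) hf.toLp = hf.toLp := by
    rw [Lp.toLp_compMeasurePreserving]
    congr 1
    ext x
    simp [τ]
  rw [h0, sub_self] at h
  have h1 := (continuous_enorm.tendsto _).comp h
  rw [enorm_zero] at h1
  refine h1.congr fun t => ?_
  rw [Function.comp, Lp.enorm_def]
  refine eLpNorm_congr_ae ?_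
  filter_upwards [Lp.coeFn_sub (Lp.compMeasurePreserving (τ t) (hmp t) hf.toLp) hf.toLp,
    Lp.coeFn_compMeasurePreserving hf.toLp (hmp t), hf.coeFn_toLp,
    (hmp t).quasiMeasurePreserving.ae hf.coeFn_toLp] with x h1 h2 h3 h4
  rw [h1, Pi.sub_apply, h2, h3, Function.comp, h4]
  rfl

variable [NormedSpace ℝ F]

/-- A smooth probability density supported in the open ball of radius `ε` around `0`. -/
structure IsMollifier (ρ : Space n → ℝ) (ε : ℝ) : Prop where
  contDiff : ContDiff ℝ ∞ ρ
  hasCompactSupport : HasCompactSupport ρ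
  nonneg : ∀ x, 0 ≤ ρ x
  integral_eq_one : ∫ x, ρ x = 1
  support_subset : Function.support ρ ⊆ Metric.ball 0 ε

/-- The mollification `x ↦ ∫ ρ(t) f(x - t) dt`. -/
noncomputable def mollify (ρ : Space n → ℝ) (f : Space n → F) (x : Space n) : F :=
  ∫ t, ρ t • f (x - t)

theorem mollify_eq_integral_sub (ρ : Space n → ℝ) (f : Space n → F) (x : Space n) :
    mollify ρ f x = ∫ y, ρ (x - y) • f y := by
  rw [mollify, ← integral_sub_left_eq_self _ volume x]
  simp

/-- Jensen's inequality for the square and the probability density `w`. -/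
theorem lintegral_mul_sq_le {X : Type*} [MeasurableSpace X] {m : Measure X} {w g : X → ℝ≥0∞}
    (hw : AEMeasurable w m) (hg : AEMeasurable g m) (h1 : ∫⁻ x, w x ∂m = 1) :
    (∫⁻ x, w x * g x ∂m) ^ 2 ≤ ∫⁻ x, w x * g x ^ 2 ∂m := by
  -- Cauchy–Schwarz for the factorization `w g = w^{1/2} (w^{1/2} g)`.
  have h := ENNReal.lintegral_mul_le_Lp_mul_Lq m Real.HolderConjugate.two_two
    (f := fun x => w x ^ (1 / 2 : ℝ)) (g := fun x => w x ^ (1 / 2 : ℝ) * g x)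
    (hw.pow_const _) ((hw.pow_const _).mul hg)
  have e1 (x : X) : w x ^ (1 / 2 : ℝ) * (w x ^ (1 / 2 : ℝ) * g x) = w x * g x := by
    rw [← mul_assoc, ← ENNReal.rpow_add_of_nonneg _ _ (by norm_num) (by norm_num)]
    norm_num
  have e2 (x : X) : (w x ^ (1 / 2 : ℝ)) ^ (2 : ℝ) = w x := by
    rw [← ENNReal.rpow_mul]; norm_num
  simp only [Pi.mul_apply, e1, e2, h1, ENNReal.one_rpow, one_mul,
    ENNReal.mul_rpow_of_nonneg _ _ (zero_le_two : (0 : ℝ) ≤ 2)] at h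
  calc _ ≤ ((∫⁻ x, w x * g x ^ (2 : ℝ) ∂m) ^ (1 / 2 : ℝ)) ^ 2 := by gcongr
    _ = _ := by
      rw [← ENNReal.rpow_natCast, ← ENNReal.rpow_mul]
      norm_num

theorem eLpNorm_two_sq {X E : Type*} [MeasurableSpace X] {m : Measure X} [NormedAddCommGroup E]
    (f : X → E) : eLpNorm f 2 m ^ 2 = ∫⁻ x, ‖f x‖ₑ ^ 2 ∂m := by
  simpa using eLpNorm_nnreal_pow_eq_lintegral (f := f) (μ := m) (p := 2) two_ne_zero

/-- Mollification moves `f` in `L²` by at most the largest distance, in `L²`, of `f` to its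
translates by vectors of the support of the mollifier. -/
theorem eLpNorm_mollify_sub_le [CompleteSpace F] {f : Space n → F} (hf : MemLp f 2 volume)
    {ρ : Space n → ℝ} {ε : ℝ} (hρ : IsMollifier ρ ε) {c : ℝ≥0∞}
    (hc : ∀ t ∈ Metric.ball (0 : Space n) ε, eLpNorm (fun x => f (x - t) - f x) 2 volume ≤ c) :
    eLpNorm (fun x => mollify ρ f x - f x) 2 volume ≤ c := by
  have hρc := hρ.contDiff.continuous
  have hρi : Integrable ρ := hρc.integrable_of_hasCompactSupport hρ.hasCompactSupport
  have hρ1 : ∫⁻ t, ‖ρ t‖ₑ = 1 := by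
    have h := ofReal_integral_norm_eq_lintegral_enorm hρi
    simp only [Real.norm_of_nonneg (hρ.nonneg _), hρ.integral_eq_one, ENNReal.ofReal_one] at h
    exact h.symm
  have hloc : LocallyIntegrable f volume := hf.locallyIntegrable (by norm_num)
  have hfs : AEStronglyMeasurable (fun q : Space n × Space n => f (q.1 - q.2) - f q.1)
      (volume.prod volume) :=
    (hf.1.comp_quasiMeasurePreserving (quasiMeasurePreserving_sub volume volume)).sub
      (hf.1.comp_quasiMeasurePreserving Measure.quasiMeasurePreserving_fst)
  have hae : ∀ᵐ x : Space n, AEStronglyMeasurable (fun t => f (x - t) - f x) volume :=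
    hfs.prodMk_left
  have pt : ∀ᵐ x : Space n, ‖mollify ρ f x - f x‖ₑ ^ 2 ≤ ∫⁻ t, ‖ρ t‖ₑ * ‖f (x - t) - f x‖ₑ ^ 2 := by
    filter_upwards [hae] with x hx
    have hi : Integrable (fun t => ρ t • f (x - t)) :=
      (hρ.hasCompactSupport.convolutionExists_left (ContinuousLinearMap.lsmul ℝ ℝ) hρc hloc x)
    have he : mollify ρ f x - f x = ∫ t, ρ t • (f (x - t) - f x) := by
      simp only [smul_sub]
      rw [integral_sub hi (hρi.smul_const _), integral_smul_const, hρ.integral_eq_one, one_smul,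
        mollify]
    rw [he]
    calc _ ≤ (∫⁻ t, ‖ρ t‖ₑ * ‖f (x - t) - f x‖ₑ) ^ 2 := by
          gcongr
          refine (enorm_integral_le_lintegral_enorm _).trans (le_of_eq ?_)
          simp only [enorm_smul]
      _ ≤ _ := lintegral_mul_sq_le hρc.enorm.aemeasurable hx.enorm hρ1
  rw [← ENNReal.pow_le_pow_left_iff two_ne_zero, eLpNorm_two_sq]
  have hmeas : AEMeasurable (fun q : Space n × Space n => ‖ρ q.2‖ₑ * ‖f (q.1 - q.2) - f q.1‖ₑ ^ 2)
      (volume.prod volume) :=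
    AEMeasurable.mul (by fun_prop) (hfs.enorm.pow_const 2)
  calc _ ≤ ∫⁻ x, ∫⁻ t, ‖ρ t‖ₑ * ‖f (x - t) - f x‖ₑ ^ 2 := lintegral_mono_ae pt
    _ = ∫⁻ t, ∫⁻ x, ‖ρ t‖ₑ * ‖f (x - t) - f x‖ₑ ^ 2 := lintegral_lintegral_swap hmeas
    _ ≤ ∫⁻ t, ‖ρ t‖ₑ * c ^ 2 := by
        refine lintegral_mono fun t => ?_
        rw [lintegral_const_mul' _ _ enorm_ne_top, ← eLpNorm_two_sq]
        by_cases ht : t ∈ Metric.ball 0 ε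
        · gcongr
          exact hc t ht
        · have : ρ t = 0 := by
            by_contra h
            exact ht (hρ.support_subset h)
          simp [this]
    _ = c ^ 2 := by rw [lintegral_mul_const _ (by fun_prop), hρ1, one_mul]

theorem tendsto_eLpNorm_mollify_sub [CompleteSpace F] {f : Space n → F} (hf : MemLp f 2 volume)
    {ρ : ℕ → Space n → ℝ} {ε : ℕ → ℝ} (hρ : ∀ᶠ k in atTop, IsMollifier (ρ k) (ε k))
    (hε : Tendsto ε atTop (𝓝 0)) :
    Tendsto (fun k => eLpNorm (fun x => mollify (ρ k) f x - f x) 2 volume) atTop (𝓝 0) := by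
  rw [ENNReal.tendsto_nhds_zero]
  intro c hc
  have h := ENNReal.tendsto_nhds_zero.1 (tendsto_eLpNorm_translate_sub hf) c hc
  obtain ⟨δ, hδ, hball⟩ := Metric.eventually_nhds_iff_ball.1 h
  filter_upwards [hρ, hε.eventually_lt_const hδ] with k hk hkδ
  exact eLpNorm_mollify_sub_le hf hk fun t ht => hball t (Metric.ball_subset_ball hkδ.le ht)

end LeastSquaresDarcy

/-! ### Density of smooth functions in `H¹` -/

namespace LeastSquaresDarcy

variable {n : ℕ}

/-- Near a point of its closure, a Lipschitz set is mapped into itself by small translations in the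
directions of a suitable open cone; only the endpoints of the translation are asked to be near the
point. -/
theorem IsBoundedLipschitz.exists_inward {Ω : Set (Space n)} (hΩ : IsBoundedLipschitz Ω)
    {x₀ : Space n} (hx₀ : x₀ ∈ closure Ω) :
    ∃ r > 0, ∃ v : Space n, ∃ δ > 0, ∀ x ∈ Ω ∩ Metric.ball x₀ r, ∀ t > (0 : ℝ),
      ∀ w ∈ Metric.ball v δ, x + t • w ∈ Metric.ball x₀ r → x + t • w ∈ Ω := by
  by_cases hin : x₀ ∈ Ω
  · obtain ⟨r, hr, hsub⟩ := Metric.isOpen_iff.1 hΩ.isOpen x₀ hin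
    exact ⟨r, hr, 0, 1, one_pos, fun x _ t _ w _ h => hsub h⟩
  · have hf : x₀ ∈ frontier Ω := by
      rw [hΩ.isOpen.frontier_eq]; exact ⟨hx₀, hin⟩
    obtain ⟨ν, γ, L, r, hν, hγ, hr, h⟩ := hΩ.lipschitz x₀ hf
    -- If `‖w - ν‖ = θ`, then a step `t w` raises `⟪ν, ·⟫` by at least `t (1 - θ)` and raises `γ`
    -- by at most `L t θ`, which is less when `θ < 1 / (L + 1)`.
    refine ⟨r, hr, ν, 1 / (L + 1), by positivity, fun x hx t ht w hw hxw => ?_⟩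
    have h1 := (h x hx.2).1 hx.1
    rw [h _ hxw]
    set π := (ℝ ∙ ν)ᗮ.orthogonalProjectionOnto
    have hd : ‖w - ν‖ * (L + 1) < 1 := by
      rw [Metric.mem_ball, dist_eq_norm, lt_div_iff₀ (by positivity)] at hw
      exact hw
    have hπ : ‖π w‖ ≤ ‖w - ν‖ := by
      have e : π w = π (w - ν) := by
        rw [map_sub, Submodule.orthogonalProjectionOnto_orthogonal_apply_eq_zero
          (Submodule.mem_span_singleton_self ν), sub_zero]
      rw [e]
      exact Submodule.norm_orthogonalProjectionOnto_apply_le _ _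
    have hinner : 1 - ‖w - ν‖ ≤ ⟪ν, w⟫ := by
      have e : ⟪ν, w⟫ = 1 + ⟪ν, w - ν⟫ := by
        rw [inner_sub_right, real_inner_self_eq_norm_sq, hν]; ring
      have := abs_real_inner_le_norm ν (w - ν)
      rw [hν, one_mul] at this
      linarith [neg_abs_le ⟪ν, w - ν⟫]
    have hlip : γ (π (x + t • w)) ≤ γ (π x) + L * (t * ‖w - ν‖) := by
      have e := hγ.dist_le_mul (π (x + t • w)) (π x)
      rw [Real.dist_eq, dist_eq_norm, map_add, map_smul, add_sub_cancel_left, norm_smul,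
        Real.norm_of_nonneg ht.le] at e
      have e2 : (L : ℝ) * (t * ‖π w‖) ≤ L * (t * ‖w - ν‖) := by gcongr
      rw [map_add, map_smul]
      linarith [le_abs_self (γ (π x + t • π w) - γ (π x))]
    rw [inner_add_right, real_inner_smul_right]
    have h2 : t * (1 - ‖w - ν‖) ≤ t * ⟪ν, w⟫ := by gcongr
    have h3 : t * (‖w - ν‖ * (L + 1)) < t * 1 := by gcongr
    linarith

/-- Mollifiers whose supports lie in a prescribed cone. -/
theorem exists_isMollifier (v : Space n) {δ t : ℝ} (hδ : 0 < δ) (ht : 0 < t) :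
    ∃ ρ : Space n → ℝ, IsMollifier ρ (t * (‖v‖ + δ)) ∧
      ∀ z ∈ tsupport ρ, ∃ w ∈ Metric.ball v δ, z = -(t • w) := by
  -- The radius `t δ / 2` of the support leaves room for the closure inside the ball of
  -- radius `t δ`.
  let b : ContDiffBump (-(t • v)) := ⟨t * δ / 4, t * δ / 2, by positivity, by
    have : 0 < t * δ := by positivity
    linarith⟩
  have hsub : tsupport (b.normed volume) ⊆ Metric.ball (-(t • v)) (t * δ) := by
    rw [b.tsupport_normed_eq]
    refine Metric.closedBall_subset_ball ?_
    have : 0 < t * δ := by positivity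
    change t * δ / 2 < t * δ
    linarith
  refine ⟨b.normed volume, ⟨b.contDiff_normed, b.hasCompactSupport_normed, b.nonneg_normed,
    b.integral_normed, fun z hz => ?_⟩, fun z hz => ⟨-(t⁻¹ • z), ?_, ?_⟩⟩
  · have h := hsub (subset_tsupport _ hz)
    rw [Metric.mem_ball, dist_eq_norm, sub_neg_eq_add] at h
    rw [mem_ball_zero_iff]
    calc ‖z‖ = ‖(z + t • v) - t • v‖ := by rw [add_sub_cancel_right]
      _ ≤ ‖z + t • v‖ + ‖t • v‖ := norm_sub_le _ _
      _ < t * δ + t * ‖v‖ := by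
        rw [norm_smul, Real.norm_of_nonneg ht.le]; gcongr
      _ = _ := by ring
  · have h := hsub hz
    rw [Metric.mem_ball, dist_eq_norm] at h ⊢
    have e : z - -(t • v) = -(t • (-(t⁻¹ • z) - v)) := by
      rw [smul_sub, smul_neg, smul_inv_smul₀ ht.ne']; abel
    rw [e, norm_neg, norm_smul, Real.norm_of_nonneg ht.le] at h
    exact lt_of_mul_lt_mul_left h ht.le
  · rw [smul_neg, smul_inv_smul₀ ht.ne', neg_neg]

theorem IsMollifier.contDiff_mollify {ρ : Space n → ℝ} {ε : ℝ} (hρ : IsMollifier ρ ε)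
    {f : Space n → ℝ} (hf : LocallyIntegrable f volume) : ContDiff ℝ ∞ (mollify ρ f) :=
  hρ.hasCompactSupport.contDiff_convolution_left (ContinuousLinearMap.lsmul ℝ ℝ) hρ.contDiff hf

theorem gradient_mollify {ρ : Space n → ℝ} {ε : ℝ} (hρ : IsMollifier ρ ε) {f : Space n → ℝ}
    (hf : LocallyIntegrable f volume) (x : Space n) :
    ∇ (mollify ρ f) x = ∫ y, f y • ∇ ρ (x - y) := by
  have h := hρ.hasCompactSupport.hasFDerivAt_convolution_left (ContinuousLinearMap.lsmul ℝ ℝ)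
    (hρ.contDiff.of_le (by simp)) hf x
  have e : fderiv ℝ (mollify ρ f) x = ∫ t, f (x - t) • fderiv ℝ ρ t := by
    refine h.fderiv.trans ?_
    rw [convolution_def]
    refine integral_congr_ae (Eventually.of_forall fun t => ?_)
    ext e
    simp [ContinuousLinearMap.precompL_apply, mul_comm]
  rw [gradient, e, ← integral_sub_left_eq_self _ volume x]
  simp only [sub_sub_cancel]
  refine (LinearIsometry.integral_comp_comm
    (InnerProductSpace.toDual ℝ (Space n)).symm.toLinearIsometry _).symm.trans ?_
  refine integral_congr_ae (Eventually.of_forall fun t => ?_)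
  simp [gradient]

theorem gradient_mul {f g : Space n → ℝ} {x : Space n} (hf : DifferentiableAt ℝ f x)
    (hg : DifferentiableAt ℝ g x) : ∇ (fun y => f y * g y) x = f x • ∇ g x + g x • ∇ f x := by
  simp [gradient, fderiv_fun_mul hf hg]

theorem gradient_const_sub {f : Space n → ℝ} (hf : Differentiable ℝ f) (x y : Space n) :
    ∇ (fun z => f (x - z)) y = -∇ f (x - y) := by
  have h : HasFDerivAt (fun z => f (x - z)) _ y :=
    (hf (x - y)).hasFDerivAt.comp y ((hasFDerivAt_id y).const_sub x)
  rw [gradient, gradient, ← map_neg, h.fderiv]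
  congr 1
  ext e
  simp

theorem IsTest.memLp_top {φ : Space n → ℝ} (h : IsTest φ) (m : Measure (Space n))
    [IsFiniteMeasureOnCompacts m] : MemLp φ ∞ m :=
  h.1.continuous.memLp_of_hasCompactSupport h.2

theorem IsTest.memLp_top_gradient {φ : Space n → ℝ} (h : IsTest φ) (m : Measure (Space n))
    [IsFiniteMeasureOnCompacts m] : MemLp (∇ φ) ∞ m :=
  (continuous_gradient h.1).memLp_of_hasCompactSupport
    ((h.2.fderiv (𝕜 := ℝ)).comp_left (g := (InnerProductSpace.toDual ℝ (Space n)).symm)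
      (map_zero _))

section Pieces

variable {Ω : Set (Space n)}

/-- The extension by zero of `η p`. -/
noncomputable def cutoff (η : Space n → ℝ) (p : H1 Ω) : Space n → ℝ :=
  Ω.indicator fun y => η y * p.1.1 y

/-- The extension by zero of the gradient `η grad p + p ∇η` of `η p`. -/
noncomputable def cutoffGrad (η : Space n → ℝ) (p : H1 Ω) : Space n → Space n :=
  Ω.indicator fun y => η y • p.1.2 y + p.1.1 y • ∇ η y

theorem memLp_cutoff (hΩ : IsOpen Ω) {η : Space n → ℝ} (hη : IsTest η) (p : H1 Ω) :
    MemLp (cutoff η p) 2 volume := by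
  rw [cutoff, memLp_indicator_iff_restrict hΩ.measurableSet]
  exact (Lp.memLp p.1.1).mul (hη.memLp_top _)

theorem memLp_cutoffGrad (hΩ : IsOpen Ω) {η : Space n → ℝ} (hη : IsTest η) (p : H1 Ω) :
    MemLp (cutoffGrad η p) 2 volume := by
  rw [cutoffGrad, memLp_indicator_iff_restrict hΩ.measurableSet]
  exact ((Lp.memLp p.1.2).smul (hη.memLp_top _)).add
    ((hη.memLp_top_gradient _).smul (Lp.memLp p.1.1))

/-- The weak gradient commutes with mollification at `x` as soon as `y ↦ η(y) ρ(x - y)` is supported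
in `Ω`, because this function may then be used as a test function. -/
theorem gradient_mollify_cutoff (hΩ : IsOpen Ω) {η : Space n → ℝ} (hη : IsTest η) (p : H1 Ω)
    {ρ : Space n → ℝ} {ε : ℝ} (hρ : IsMollifier ρ ε) {x : Space n}
    (hx : ∀ y ∈ tsupport η, x - y ∈ tsupport ρ → y ∈ Ω) :
    ∇ (mollify ρ (cutoff η p)) x = mollify ρ (cutoffGrad η p) x := by
  have hρx : ContDiff ℝ ∞ fun y => ρ (x - y) := hρ.contDiff.comp (by fun_prop)
  have hρd : Differentiable ℝ ρ := hρ.contDiff.differentiable (by simp)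
  have hψ : IsTest fun y => η y * ρ (x - y) := ⟨hη.1.mul hρx, hη.2.mul_right⟩
  have hsupp : tsupport (fun y => η y * ρ (x - y)) ⊆ Ω := by
    intro y hy
    refine hx y (tsupport_mul_subset_left hy) ?_
    have h1 := tsupport_mul_subset_right hy
    exact tsupport_comp_subset_preimage ρ (f := fun y => x - y) (by fun_prop) h1
  have hgrad (y : Space n) :
      ∇ (fun y => η y * ρ (x - y)) y = ρ (x - y) • ∇ η y - η y • ∇ ρ (x - y) := by
    rw [gradient_mul (hη.1.differentiable (by simp) y) (hρx.differentiable (by simp) y),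
      gradient_const_sub hρd, smul_neg]
    abel
  have hρt : IsTest ρ := ⟨hρ.contDiff, hρ.hasCompactSupport⟩
  have hρtx : IsTest fun y => ρ (x - y) :=
    ⟨hρx, hρ.hasCompactSupport.comp_homeomorph (Homeomorph.subLeft x)⟩
  have i1 : Integrable (fun y => (ρ (x - y) * p.1.1 y) • ∇ η y) (vol Ω) :=
    memLp_one_iff_integrable.1 ((hη.memLp_grad Ω).smul
      (q := 2) (MemLp.mul (r := 2) (Lp.memLp p.1.1) (hρtx.memLp_top _)))
  have i2 : Integrable (fun y => (η y * p.1.1 y) • ∇ ρ (x - y)) (vol Ω) := by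
    have hg : MemLp (fun y => ∇ ρ (x - y)) 2 (vol Ω) := by
      have := (hρtx.memLp_grad Ω).neg
      refine this.ae_eq (Eventually.of_forall fun y => ?_)
      simp [gradient_const_sub hρd]
    exact memLp_one_iff_integrable.1 (hg.smul (q := 2)
      (MemLp.mul (r := 2) (Lp.memLp p.1.1) (hη.memLp_top _)))
  have i3 : Integrable (fun y => (η y * ρ (x - y)) • p.1.2 y) (vol Ω) := hψ.integrable_smul p.1.2
  have hw := p.2 _ hψ hsupp
  have e1 : ∫ y in Ω, p.1.1 y • ∇ (fun y => η y * ρ (x - y)) y =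
      ∫ y in Ω, ((ρ (x - y) * p.1.1 y) • ∇ η y - (η y * p.1.1 y) • ∇ ρ (x - y)) := by
    refine integral_congr_ae (Eventually.of_forall fun y => ?_)
    simp only [hgrad, smul_sub, smul_smul, mul_comm]
  rw [e1, integral_sub i1 i2] at hw
  have e2 : ∇ (mollify ρ (cutoff η p)) x = ∫ y in Ω, (η y * p.1.1 y) • ∇ ρ (x - y) := by
    rw [gradient_mollify hρ ((memLp_cutoff hΩ hη p).locallyIntegrable (by norm_num)),
      ← integral_indicator hΩ.measurableSet]
    refine integral_congr_ae (Eventually.of_forall fun y => ?_)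
    by_cases hy : y ∈ Ω <;> simp [cutoff, hy]
  have e3 : mollify ρ (cutoffGrad η p) x =
      ∫ y in Ω, ((η y * ρ (x - y)) • p.1.2 y + (ρ (x - y) * p.1.1 y) • ∇ η y) := by
    rw [mollify_eq_integral_sub, ← integral_indicator hΩ.measurableSet]
    refine integral_congr_ae (Eventually.of_forall fun y => ?_)
    by_cases hy : y ∈ Ω <;> simp [cutoffGrad, hy, smul_smul, mul_comm]
  rw [e2, e3, integral_add i3 i1]
  rw [sub_eq_iff_eq_add] at hw
  rw [hw]
  abel

/-- The part `η p` of `p` near a point of the closure of `Ω` is approximated by mollification with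
kernels that only look into the cone of inward directions. -/
theorem IsBoundedLipschitz.exists_tendsto_cutoff (hΩ : IsBoundedLipschitz Ω) {x₀ : Space n}
    (hx₀ : x₀ ∈ closure Ω) :
    ∃ r > 0, ∀ η : Space n → ℝ, IsTest η → tsupport η ⊆ Metric.ball x₀ r → ∀ p : H1 Ω,
      ∃ φ : ℕ → Space n → ℝ, (∀ k, ContDiff ℝ ∞ (φ k)) ∧
        Tendsto (fun k => eLpNorm (fun x => φ k x - cutoff η p x) 2 (vol Ω)) atTop (𝓝 0) ∧
        Tendsto (fun k => eLpNorm (fun x => ∇ (φ k) x - cutoffGrad η p x) 2 (vol Ω))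
          atTop (𝓝 0) := by
  obtain ⟨r, hr, v, δ, hδ, hin⟩ := hΩ.exists_inward hx₀
  refine ⟨r, hr, fun η hη hsub p => ?_⟩
  obtain ⟨s, hs, hthick⟩ := hη.2.isCompact.exists_thickening_subset_open Metric.isOpen_ball hsub
  set t : ℕ → ℝ := fun k => 1 / ((k : ℝ) + 1) with ht
  have htpos (k : ℕ) : 0 < t k := by positivity
  choose ρ hρ hcone using fun k => exists_isMollifier v hδ (htpos k)
  have hε : Tendsto (fun k => t k * (‖v‖ + δ)) atTop (𝓝 0) := by
    simpa only [zero_mul] using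
      (tendsto_one_div_add_atTop_nhds_zero_nat (𝕜 := ℝ)).mul_const (‖v‖ + δ)
  have hP := memLp_cutoff hΩ.isOpen hη p
  have hG := memLp_cutoffGrad hΩ.isOpen hη p
  refine ⟨fun k => mollify (ρ k) (cutoff η p), fun k => (hρ k).contDiff_mollify
    (hP.locallyIntegrable (by norm_num)), ?_, ?_⟩
  · exact tendsto_of_tendsto_of_tendsto_of_le_of_le tendsto_const_nhds
      (tendsto_eLpNorm_mollify_sub hP (Eventually.of_forall hρ) hε) (fun _ => zero_le)
      fun k => eLpNorm_mono_measure _ Measure.restrict_le_self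
  · refine tendsto_of_tendsto_of_tendsto_of_le_of_le' tendsto_const_nhds
      (tendsto_eLpNorm_mollify_sub hG (Eventually.of_forall hρ) hε)
      (Eventually.of_forall fun _ => zero_le) ?_
    filter_upwards [hε.eventually_lt_const hs] with k hk
    refine (le_of_eq (eLpNorm_congr_ae ?_)).trans
      (eLpNorm_mono_measure _ (Measure.restrict_le_self (s := Ω)))
    filter_upwards [ae_restrict_mem hΩ.isOpen.measurableSet] with x hx
    rw [gradient_mollify_cutoff hΩ.isOpen hη p (hρ k)]
    intro y hy hxy
    -- Here `x - y = -t w`, so that `y` is reached from `x ∈ Ω` by the inward step `t w`.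
    obtain ⟨w, hw, hxw⟩ := hcone k _ hxy
    have hyx : y = x + t k • w := by rw [← sub_sub_cancel x y, hxw, sub_neg_eq_add]
    have hnorm : dist x y < s := by
      rw [hyx, dist_eq_norm, sub_add_cancel_left, norm_neg, norm_smul,
        Real.norm_of_nonneg (htpos k).le]
      refine lt_of_le_of_lt ?_ hk
      rw [Metric.mem_ball, dist_eq_norm] at hw
      have : ‖w‖ ≤ ‖v‖ + δ := by
        have := norm_add_le v (w - v)
        rw [add_sub_cancel] at this
        linarith
      have := (htpos k).le
      gcongr
    have hxr : x ∈ Metric.ball x₀ r := hthick (Metric.mem_thickening_iff.2 ⟨y, hy, hnorm⟩)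
    rw [hyx]
    exact hin x ⟨hx, hxr⟩ _ (htpos k) w hw (hyx ▸ hsub hy)

end Pieces

variable {Ω : Set (Space n)}

theorem gradient_sub {f g : Space n → ℝ} (hf : Differentiable ℝ f) (hg : Differentiable ℝ g)
    (x : Space n) : ∇ (fun y => f y - g y) x = ∇ f x - ∇ g x := by
  simp [gradient, fderiv_fun_sub (hf x) (hg x)]

theorem gradient_sum {ι : Type*} [Fintype ι] {f : ι → Space n → ℝ}
    (hf : ∀ i, Differentiable ℝ (f i)) (x : Space n) :
    ∇ (fun y => ∑ i, f i y) x = ∑ i, ∇ (f i) x := by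
  simp [gradient, fderiv_fun_sum fun i _ => hf i x]

/-- A finite smooth partition of unity on `Ω`, subordinate to any choice of balls around the points
of the closure. -/
theorem exists_partition (hΩ : IsBoundedLipschitz Ω) {r : Space n → ℝ}
    (hr : ∀ x ∈ closure Ω, 0 < r x) :
    ∃ (t : Finset (Space n)) (η : t → Space n → ℝ), (∀ i : t, (i : Space n) ∈ closure Ω) ∧
      (∀ i, IsTest (η i)) ∧ (∀ i : t, tsupport (η i) ⊆ Metric.ball (i : Space n) (r i)) ∧
      ∀ x ∈ Ω, ∑ i, η i x = 1 := by
  obtain ⟨t, ht, hcov⟩ := hΩ.isBounded.isCompact_closure.elim_nhds_subcover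
    (fun x => Metric.ball x (r x)) fun x hx => Metric.ball_mem_nhds x (hr x hx)
  obtain ⟨f, hf⟩ := SmoothPartitionOfUnity.exists_isSubordinate
    (modelWithCornersSelf ℝ (Space n)) isClosed_closure
    (fun i : t => Metric.ball (i : Space n) (r i)) (fun _ => Metric.isOpen_ball)
    (hcov.trans (by
      intro x hx
      simp only [Set.mem_iUnion] at hx ⊢
      obtain ⟨y, hy, hxy⟩ := hx
      exact ⟨⟨y, hy⟩, hxy⟩))
  refine ⟨t, fun i => f i, fun i => ht i i.2, fun i => ⟨(f i).contMDiff.contDiff, ?_⟩, hf,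
    fun x hx => ?_⟩
  · exact HasCompactSupport.of_support_subset_isCompact (isCompact_closedBall (i : Space n) (r i))
      ((subset_tsupport _).trans ((hf i).trans Metric.ball_subset_closedBall))
  · rw [← finsum_eq_sum_of_fintype]
    exact f.sum_eq_one (subset_closure hx)

/-- Smooth functions are dense in `H¹` of a bounded Lipschitz set. -/
theorem IsBoundedLipschitz.exists_contDiff_tendsto (hΩ : IsBoundedLipschitz Ω) (p : H1 Ω) :
    ∃ φ : ℕ → Space n → ℝ, (∀ k, ContDiff ℝ ∞ (φ k)) ∧
      Tendsto (fun k => eLpNorm (fun x => φ k x - p.1.1 x) 2 (vol Ω)) atTop (𝓝 0) ∧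
      Tendsto (fun k => eLpNorm (fun x => ∇ (φ k) x - p.1.2 x) 2 (vol Ω)) atTop (𝓝 0) := by
  choose! r hr hcut using fun x₀ (hx₀ : x₀ ∈ closure Ω) => hΩ.exists_tendsto_cutoff hx₀
  obtain ⟨t, η, htΩ, hη, hsub, hsum⟩ := exists_partition hΩ hr
  choose φ hφ h0 h1 using fun i : t => hcut i (htΩ i) (η i) (hη i) (hsub i) p
  have hsumgrad (x : Space n) (hx : x ∈ Ω) : ∑ i, ∇ (η i) x = 0 := by
    rw [← gradient_sum fun i => (hη i).1.differentiable (by simp)]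
    have : (fun y => ∑ i, η i y) =ᶠ[𝓝 x] fun _ => 1 := by
      filter_upwards [hΩ.isOpen.mem_nhds hx] with y hy using hsum y hy
    rw [gradient, this.fderiv_eq]
    simp
  have hdom {E : Type} [NormedAddCommGroup E] {a : t → ℕ → Space n → E} {b : t → Space n → E}
      {c : ℕ → Space n → E} (ha : ∀ i k, AEStronglyMeasurable (fun x => a i k x - b i x) (vol Ω))
      (hc : ∀ k, ∀ x ∈ Ω, c k x = ∑ i, (a i k x - b i x))
      (ht : ∀ i, Tendsto (fun k => eLpNorm (fun x => a i k x - b i x) 2 (vol Ω)) atTop (𝓝 0)) :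
      Tendsto (fun k => eLpNorm (c k) 2 (vol Ω)) atTop (𝓝 0) := by
    have hlim := tendsto_finsetSum Finset.univ fun i _ => ht i
    rw [Finset.sum_const_zero] at hlim
    refine tendsto_of_tendsto_of_tendsto_of_le_of_le tendsto_const_nhds hlim
      (fun _ => zero_le) fun k => ?_
    refine (le_of_eq (eLpNorm_congr_ae ?_)).trans (eLpNorm_sum_le (fun i _ => ha i k) (by norm_num))
    filter_upwards [ae_restrict_mem hΩ.isOpen.measurableSet] with x hx
    rw [hc k x hx, Finset.sum_apply]
  refine ⟨fun k x => ∑ i, φ i k x, fun k => ContDiff.sum fun i _ => hφ i k, ?_, ?_⟩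
  · refine hdom (fun i k => ?_) (fun k x hx => ?_) h0
    · exact (hφ i k).continuous.aestronglyMeasurable.sub
        (memLp_cutoff hΩ.isOpen (hη i) p).1.restrict
    · rw [Finset.sum_sub_distrib]
      congr 1
      simp only [cutoff, Set.indicator_of_mem hx]
      rw [← Finset.sum_mul, hsum x hx, one_mul]
  · refine hdom (fun i k => ?_) (fun k x hx => ?_) h1
    · exact (continuous_gradient (hφ i k)).aestronglyMeasurable.sub
        (memLp_cutoffGrad hΩ.isOpen (hη i) p).1.restrict
    · rw [Finset.sum_sub_distrib, gradient_sum fun i => (hφ i k).differentiable (by simp)]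
      congr 1
      simp only [cutoffGrad, Set.indicator_of_mem hx]
      rw [Finset.sum_add_distrib, ← Finset.sum_smul, hsum x hx, one_smul, ← Finset.smul_sum,
        hsumgrad x hx, smul_zero, add_zero]

/-! ### The trace operator -/

/-- The trace inequality for smooth functions, in terms of norms. -/
theorem IsBoundedLipschitz.exists_eLpNorm_surf_le (hΩ : IsBoundedLipschitz Ω) :
    ∃ C : NNReal, ∀ φ : Space n → ℝ, ContDiff ℝ ∞ φ →
      eLpNorm φ 2 (surf Ω) ≤ C * (eLpNorm φ 2 (vol Ω) + eLpNorm (∇ φ) 2 (vol Ω)) := by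
  obtain ⟨C, hC⟩ := hΩ.exists_lintegral_surf_le
  refine ⟨NNReal.sqrt C, fun φ hφ => ?_⟩
  have h := hC φ hφ
  have hm : Measurable fun x => ‖φ x‖ₑ ^ 2 := hφ.continuous.measurable.enorm.pow_const 2
  simp only [energy] at h
  rw [lintegral_add_left hm, ← eLpNorm_two_sq, ← eLpNorm_two_sq, ← eLpNorm_two_sq] at h
  rw [← ENNReal.pow_le_pow_left_iff two_ne_zero, mul_pow, ← ENNReal.coe_pow, NNReal.sq_sqrt]
  refine h.trans ?_
  gcongr
  rw [add_sq]
  gcongr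
  exact le_self_add

theorem memLp_vol_of_continuous (ho : IsOpen Ω) (hΩ : Bornology.IsBounded Ω) {E : Type*}
    [NormedAddCommGroup E] {f : Space n → E} (hf : Continuous f) : MemLp f 2 (vol Ω) := by
  have : IsFiniteMeasure (vol Ω) := isFiniteMeasure_restrict.2 hΩ.measure_lt_top.ne
  obtain ⟨C, hC⟩ := hΩ.isCompact_closure.exists_bound_of_continuousOn hf.continuousOn
  refine MemLp.of_bound hf.aestronglyMeasurable C ?_
  filter_upwards [ae_restrict_mem ho.measurableSet] with x hx using hC x (subset_closure hx)

theorem IsBoundedLipschitz.memLp_surf (hΩ : IsBoundedLipschitz Ω) {φ : Space n → ℝ}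
    (hφ : ContDiff ℝ ∞ φ) : MemLp φ 2 (surf Ω) := by
  obtain ⟨C, hC⟩ := hΩ.exists_eLpNorm_surf_le
  refine ⟨hφ.continuous.aestronglyMeasurable, (hC φ hφ).trans_lt ?_⟩
  exact ENNReal.mul_lt_top ENNReal.coe_lt_top (ENNReal.add_lt_top.2
    ⟨(memLp_vol_of_continuous hΩ.isOpen hΩ.isBounded hφ.continuous).2,
      (memLp_vol_of_continuous hΩ.isOpen hΩ.isBounded (continuous_gradient hφ)).2⟩)

/-- Every function of `H¹` has a trace: the boundary values of smooth approximations form a Cauchy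
sequence, by the trace inequality applied to their differences. -/
theorem IsBoundedLipschitz.exists_isTrace (hΩ : IsBoundedLipschitz Ω) (p : H1 Ω) :
    ∃ g, IsTrace Ω p g := by
  obtain ⟨C, hC⟩ := hΩ.exists_eLpNorm_surf_le
  obtain ⟨φ, hφ, h0, h1⟩ := hΩ.exists_contDiff_tendsto p
  have hm (k : ℕ) : MemLp (φ k) 2 (surf Ω) := hΩ.memLp_surf (hφ k)
  set e : ℕ → ℝ≥0∞ := fun k => C * (eLpNorm (fun x => φ k x - p.1.1 x) 2 (vol Ω) +
    eLpNorm (fun x => ∇ (φ k) x - p.1.2 x) 2 (vol Ω)) with he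
  have he0 : Tendsto e atTop (𝓝 0) := by
    have := ENNReal.Tendsto.const_mul (a := (C : ℝ≥0∞)) (h0.add h1) (Or.inr ENNReal.coe_ne_top)
    simpa using this
  have hedist (k l : ℕ) : edist (hm k).toLp (hm l).toLp ≤ e k + e l := by
    rw [Lp.edist_toLp_toLp]
    refine (hC (fun x => φ k x - φ l x) ((hφ k).sub (hφ l))).trans ?_
    rw [he, ← mul_add]
    refine mul_le_mul_right ?_ _
    rw [add_add_add_comm]
    have hgk := (continuous_gradient (hφ k)).aestronglyMeasurable (μ := vol Ω)
    have hgl := (continuous_gradient (hφ l)).aestronglyMeasurable (μ := vol Ω)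
    refine add_le_add ?_ ?_
    · refine le_trans (le_of_eq ?_) (eLpNorm_sub_le
        ((hφ k).continuous.aestronglyMeasurable.sub (Lp.aestronglyMeasurable p.1.1))
        ((hφ l).continuous.aestronglyMeasurable.sub (Lp.aestronglyMeasurable p.1.1)) (by norm_num))
      congr 1
      ext x
      simp
    · refine le_trans (le_of_eq ?_) (eLpNorm_sub_le (hgk.sub (Lp.aestronglyMeasurable p.1.2))
        (hgl.sub (Lp.aestronglyMeasurable p.1.2)) (by norm_num))
      congr 1
      funext x
      rw [gradient_sub ((hφ k).differentiable (by simp)) ((hφ l).differentiable (by simp))]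
      simp
  have hcau : CauchySeq fun k => (hm k).toLp := by
    rw [EMetric.cauchySeq_iff]
    intro ε hε
    obtain ⟨N, hN⟩ := eventually_atTop.1 (he0.eventually_lt_const (ENNReal.half_pos hε.ne'))
    refine ⟨N, fun k hk l hl => (hedist k l).trans_lt ?_⟩
    rw [← ENNReal.add_halves ε]
    exact ENNReal.add_lt_add (hN k hk) (hN l hl)
  obtain ⟨g, hg⟩ := cauchySeq_tendsto_of_complete hcau
  refine ⟨g, φ, hφ, h0, h1, ?_⟩
  rw [tendsto_iff_edist_tendsto_0] at hg
  refine hg.congr fun k => ?_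
  rw [Lp.edist_def]
  refine eLpNorm_congr_ae ?_
  filter_upwards [(hm k).coeFn_toLp] with x hx
  rw [Pi.sub_apply, hx]

theorem IsBoundedLipschitz.isTrace_trace (hΩ : IsBoundedLipschitz Ω) (p : H1 Ω) :
    IsTrace Ω p (trace Ω p) := by
  have h := hΩ.exists_isTrace p
  rw [trace, dif_pos h]
  exact h.choose_spec

/-- The trace inequality in `H¹`, from the one for smooth functions by passage to the limit. -/
theorem IsBoundedLipschitz.exists_norm_le_of_isTrace (hΩ : IsBoundedLipschitz Ω) :
    ∃ C : NNReal, ∀ (p : H1 Ω) (g : Lp ℝ 2 (surf Ω)), IsTrace Ω p g →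
      ‖g‖ ≤ C * (‖p.1.1‖ + ‖p.1.2‖) := by
  obtain ⟨C, hC⟩ := hΩ.exists_eLpNorm_surf_le
  refine ⟨C, ?_⟩
  rintro p g ⟨φ, hφ, h0, h1, h2⟩
  have key : ‖g‖ₑ ≤ C * (‖p.1.1‖ₑ + ‖p.1.2‖ₑ) := by
    have hlim := h2.add (ENNReal.Tendsto.const_mul (a := (C : ℝ≥0∞))
      ((h0.add_const ‖p.1.1‖ₑ).add (h1.add_const ‖p.1.2‖ₑ)) (Or.inr ENNReal.coe_ne_top))
    simp only [zero_add] at hlim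
    refine ge_of_tendsto' hlim fun k => ?_
    have hc := (hφ k).continuous
    have hgc := continuous_gradient (hφ k)
    have tri {X E : Type} [MeasurableSpace X] {m : Measure X} [NormedAddCommGroup E]
        {a b : X → E} (ha : AEStronglyMeasurable a m) (hb : AEStronglyMeasurable b m) :
        eLpNorm a 2 m ≤ eLpNorm (fun x => a x - b x) 2 m + eLpNorm b 2 m := by
      refine le_trans (le_of_eq ?_) (eLpNorm_add_le (ha.sub hb) hb (by norm_num))
      congr 1
      ext x
      simp
    have t0 := tri (hc.aestronglyMeasurable (μ := vol Ω)) (Lp.aestronglyMeasurable p.1.1)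
    have t1 := tri (hgc.aestronglyMeasurable (μ := vol Ω)) (Lp.aestronglyMeasurable p.1.2)
    have t2 := tri (Lp.aestronglyMeasurable g) (hc.aestronglyMeasurable (μ := surf Ω))
    rw [← Lp.enorm_def] at t0 t1 t2
    have hsymm : eLpNorm (fun x => g x - φ k x) 2 (surf Ω) =
        eLpNorm (fun x => φ k x - g x) 2 (surf Ω) := eLpNorm_sub_comm (g : Space n → ℝ) (φ k) _ _
    rw [hsymm] at t2
    refine t2.trans (add_le_add_right ((hC (φ k) (hφ k)).trans ?_) _)
    gcongr
  have h := ENNReal.toReal_mono (by finiteness) key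
  rw [ENNReal.toReal_mul, ENNReal.toReal_add enorm_ne_top enorm_ne_top] at h
  simpa using h

theorem IsBoundedLipschitz.exists_isTraceConst (hΩ : IsBoundedLipschitz Ω) (Γ : Set (Space n)) :
    ∃ C : ℝ, IsTraceConst Ω Γ C := by
  obtain ⟨C, hC⟩ := hΩ.exists_norm_le_of_isTrace
  -- The summand `1` makes the constant positive even if `C = 0`.
  refine ⟨2 * C + 1, by positivity, fun p => ?_⟩
  have h := hC p _ (hΩ.isTrace_trace p)
  have hN := normH1_eq p
  have h0 : 0 ≤ normH1 p := Real.sqrt_nonneg _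
  have hp : ‖p.1.1‖ ≤ normH1 p := by
    rw [hN]; exact Real.le_sqrt_of_sq_le (le_add_of_nonneg_right (sq_nonneg _))
  have hG : ‖p.1.2‖ ≤ normH1 p := by
    rw [hN]; exact Real.le_sqrt_of_sq_le (le_add_of_nonneg_left (sq_nonneg _))
  have hint : ∫ x, (trace Ω p x) ^ 2 ∂(surfOn Ω Γ) ≤ ‖trace Ω p‖ ^ 2 := by
    rw [← integral_norm_sq]
    simp only [Real.norm_eq_abs, sq_abs]
    exact setIntegral_le_integral (Lp.memLp (trace Ω p)).integrable_sq
      (Eventually.of_forall fun x => sq_nonneg _)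
  calc _ ≤ ‖trace Ω p‖ := (Real.sqrt_le_sqrt hint).trans (by rw [Real.sqrt_sq (norm_nonneg _)])
    _ ≤ C * (‖p.1.1‖ + ‖p.1.2‖) := h
    _ ≤ C * (normH1 p + normH1 p) := by gcongr
    _ ≤ _ := by linarith

end LeastSquaresDarcy

open LeastSquaresDarcy in
theorem mainTheorem3 (n : ℕ) (Ω Γu Γp : Set (Space n)) (hΩ : IsBoundedLipschitz Ω)
    (hΓu : MeasurableSet Γu) (hΓp : MeasurableSet Γp)
    (hcover : Γu ∪ Γp = frontier Ω) (hdisj : Disjoint Γu Γp) (hpos : 0 < surf Ω Γp) :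
    (∃ Ctr : ℝ, IsTraceConst Ω Γp Ctr) ∧
    ∀ Ctr : ℝ, IsTraceConst Ω Γp Ctr →
      ∀ (μ kmin kmax : ℝ), 0 < μ → 0 < kmin → kmin ≤ kmax →
        ∀ K : Space n → Matrix (Fin n) (Fin n) ℝ, IsPermeability Ω K kmin kmax →
          ∀ W U : USpace Ω Γu,
            |bilinB Γp μ K W U| ≤
              (kmax / μ * (μ * kmin⁻¹ + 1) ^ 2 + 2 + Ctr ^ 2) * normU W * normU U := by
  exact ⟨hΩ.exists_isTraceConst Γp, fun Ctr hCtr μ kmin kmax hμ hmin hle K hK W U =>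
    abs_bilinB_le hCtr hμ hmin hle hK W U⟩
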